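/- Let $C_1=r_1\cup t_1$ and $C_2=r_2\cup t_2$ be the Chapman domains: $r_1$ is an open square of side length $1$, $t_1$ is an open right isosceles triangle with legs of length $2$, $r_2$ is an open rectangle of length $2$ and height $1$, and $t_2$ is an open right isosceles triangle with legs of length $\sqrt2$, all placed in the plane $\mathbb R^2$ so that $r_1\cap t_1=\emptyset$ and $r_2\cap t_2=\emptyset$. For an open set $\Omega\subset\mathbb R^2$, the Dirichlet heat content of $\Omega$ is the function $$Q_\Omega(t)=\int_\Omega u(t,x)\,dx,\qquad t>0,$$ where $u$ is the bounded classical solution of $\partial_t u=\Delta u$ on $(0,\infty)\times\Omega$ that is continuous on $(0,\infty)\times\overline\Omega$ and satisfies $u(t,x)=0$ for $t>0$, $x\in\partial\Omega$, and $\lim_{t\to0^+}u(t,x)=1$ for $x\in\Omega$. Then, for both $C_1$ and $C_2$, such a solution exists, and $C_1$ and $C_2$ have different heat content: there is a $t>0$ with $Q_{C_1}(t)\neq Q_{C_2}(t)$. -/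

import Mathlib

open scoped Topology

/-- The Euclidean plane. -/
abbrev Plane : Type := EuclideanSpace ℝ (Fin 2)

/-- `S` is an open rectangle of length `L` and height `H`, placed anywhere in the plane
by a rigid motion. -/
def IsOpenRectangle (L H : ℝ) (S : Set Plane) : Prop :=
  ∃ φ : Plane ≃ᵃⁱ[ℝ] Plane,
    S = φ '' {p : Plane | 0 < p 0 ∧ p 0 < L ∧ 0 < p 1 ∧ p 1 < H}

/-- `S` is an open right isosceles triangle whose two legs have length `L`, placed anywhere in
the plane by a rigid motion. -/
def IsOpenRightIsoscelesTriangle (L : ℝ) (S : Set Plane) : Prop :=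
  ∃ φ : Plane ≃ᵃⁱ[ℝ] Plane,
    S = φ '' {p : Plane | 0 < p 0 ∧ 0 < p 1 ∧ p 0 + p 1 < L}

/-- `C` is a first Chapman domain: the disjoint union of an open unit square and an open right
isosceles triangle with legs of length `2`. -/
def IsChapmanDomain₁ (C : Set Plane) : Prop :=
  ∃ r t : Set Plane, IsOpenRectangle 1 1 r ∧ IsOpenRightIsoscelesTriangle 2 t ∧
    Disjoint r t ∧ C = r ∪ t

/-- `C` is a second Chapman domain: the disjoint union of an open `2 × 1` rectangle and an open
right isosceles triangle with legs of length `√2`. -/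
def IsChapmanDomain₂ (C : Set Plane) : Prop :=
  ∃ r t : Set Plane, IsOpenRectangle 2 1 r ∧ IsOpenRightIsoscelesTriangle (√2) t ∧
    Disjoint r t ∧ C = r ∪ t

/-- `u` is the (bounded, classical) solution on the open set `Ω`, for times `t > 0`, of the heat
equation `∂u/∂t = Δu` with Dirichlet boundary condition `u = 0` on `∂Ω` and initial
temperature `1` in `Ω`. Here `u t x` is the temperature at the point `x` at time `t`; only the
values at `t > 0` and `x ∈ closure Ω` matter. The initial and the boundary data do not agree on
`∂Ω` at time `0`, so the initial value is attained at the points of `Ω`, boundedly. -/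
structure IsDirichletHeatSolution (Ω : Set Plane) (u : ℝ → Plane → ℝ) : Prop where
  contDiffOn : ContDiffOn ℝ 2 (fun p : ℝ × Plane => u p.1 p.2) (Set.Ioi 0 ×ˢ Ω)
  continuousOn : ContinuousOn (fun p : ℝ × Plane => u p.1 p.2) (Set.Ioi 0 ×ˢ closure Ω)
  heat_eq : ∀ t : ℝ, 0 < t → ∀ x ∈ Ω,
    HasDerivAt (fun s : ℝ => u s x) (Laplacian.laplacian (u t) x) t
  boundary : ∀ t : ℝ, 0 < t → ∀ x ∈ frontier Ω, u t x = 0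
  initial : ∀ x ∈ Ω, Filter.Tendsto (fun t : ℝ => u t x) (𝓝[>] 0) (𝓝 1)
  bounded : ∃ M : ℝ, ∀ t : ℝ, 0 < t → ∀ x ∈ Ω, |u t x| ≤ M

/-- `Q` is the Dirichlet heat content of `Ω`, as a function of the time `t > 0`: the integral
over `Ω` of the temperature at time `t`. -/
def IsHeatContent (Ω : Set Plane) (Q : ℝ → ℝ) : Prop :=
  ∃ u : ℝ → Plane → ℝ, IsDirichletHeatSolution Ω u ∧ ∀ t : ℝ, 0 < t → Q t = ∫ x in Ω, u t x

/-! The two heat contents are separated by their large-time asymptotics. With Dirichlet conditions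
the lowest eigenvalue of an `L × H` rectangle is `π²(1/L² + 1/H²)`, and that of a right isosceles
triangle with legs `L` is `5π²/L²`. Both Chapman domains therefore cool at the rate `5π²/4`, but in
different components: in the triangle with legs `2` of the first, in the `2 × 1` rectangle of the
second. The other components decay faster, at rates `2π²` and `5π²/2`. Multiplied by `exp (5π²t/4)`,
the contents tend to `1024/(9π⁴)` and `128/π⁴ = 1152/(9π⁴)`, so they cannot agree for all `t`.

Solutions are obtained by reflection. The datum `1` on a square, rectangle or right isosceles
triangle extends to a bounded function on the plane that is odd under reflection in each side
(`rectWave`, `triWave`). Its free heat flow commutes with isometries, hence is odd too and vanishes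
on the sides (`heatFlow_eq_zero_of_odd`). Rigid motions and disjoint unions preserve solutions,
which gives existence.

Any other bounded solution must have the same content (`IsDirichletHeatSolution.unique`). Initial
and boundary data are incompatible, so the maximum principle cannot start at time `0`. It starts at
time `ε`, with the free flow of `|u - v|` as a barrier; the `L¹` norm of that datum tends to `0`
with `ε`, and the flow maps `L¹` to `L^∞`.

The asymptotics need no spectral theory. The plane flow is an iterated line flow, and Poisson
summation turns the line flow of an odd periodic function into a sine series whose first two modes
dominate (`lineFlow_approx`). For the triangle the `(1,1)` mode drops out by symmetry, and the
leading term is the sum of the `(1,2)` and `(2,1)` modes (`heatFlow_triWave_approx`). -/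

noncomputable section

open MeasureTheory Filter

/-! ### Convolutions with Gaussians times monomials. -/

/-- The monomial `w₀ⁱ w₁ʲ` times the Gaussian `exp (-s |w|²)`. -/
def gaussMonomial (i j : ℕ) (s : ℝ) (w : Plane) : ℝ :=
  w 0 ^ i * w 1 ^ j * Real.exp (-s * (w 0 ^ 2 + w 1 ^ 2))

/-- The convolution of `f` with a monomial times a Gaussian, as a function of the
parameter of the Gaussian and of the point. -/
def gaussConv (f : Plane → ℝ) (i j : ℕ) (p : ℝ × Plane) : ℝ :=
  ∫ y, gaussMonomial i j p.1 (p.2 - y) * f y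

lemma Plane.norm_sq (w : Plane) : ‖w‖ ^ 2 = w 0 ^ 2 + w 1 ^ 2 := by
  rw [EuclideanSpace.real_norm_sq_eq, Fin.sum_univ_two]

/-- Combine `|x|ⁱ ≤ i! e^{|x|}` with the completed square `|x| ≤ 1/(4a) + a x²`. -/
lemma abs_pow_le_exp_sq {a : ℝ} (ha : 0 < a) (i : ℕ) (x : ℝ) :
    |x| ^ i ≤ i.factorial * Real.exp (1 / (4 * a)) * Real.exp (a * x ^ 2) := by
  have h1 : |x| ^ i ≤ i.factorial * Real.exp |x| := by
    have := Real.pow_div_factorial_le_exp |x| (abs_nonneg x) i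
    rwa [div_le_iff₀ (by positivity), mul_comm] at this
  have h2 : |x| ≤ 1 / (4 * a) + a * x ^ 2 := by
    rw [← sq_abs x]
    have : 1 / (4 * a) + a * |x| ^ 2 - |x| = a * (|x| - 1 / (2 * a)) ^ 2 := by
      field_simp; ring
    nlinarith [mul_nonneg ha.le (sq_nonneg (|x| - 1 / (2 * a)))]
  calc |x| ^ i ≤ i.factorial * Real.exp |x| := h1
    _ ≤ i.factorial * Real.exp (1 / (4 * a) + a * x ^ 2) := by gcongr
    _ = _ := by rw [Real.exp_add]; ring

/-- Half of the Gaussian decay absorbs the monomial. Uniformity in `s` is what differentiation under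
the integral requires. -/
lemma abs_gaussMonomial_le {a : ℝ} (ha : 0 < a) (i j : ℕ) :
    ∃ C : ℝ, 0 ≤ C ∧ ∀ s, 2 * a ≤ s → ∀ w : Plane,
      |gaussMonomial i j s w| ≤ C * Real.exp (-a * ‖w‖ ^ 2) := by
  refine ⟨(i.factorial * Real.exp (1 / (4 * a))) * (j.factorial * Real.exp (1 / (4 * a))),
    by positivity, fun s hs w => ?_⟩
  rw [gaussMonomial, abs_mul, abs_mul, abs_pow, abs_pow, Real.abs_exp, Plane.norm_sq]
  have h3 : Real.exp (-s * (w 0 ^ 2 + w 1 ^ 2)) ≤ Real.exp (-(2 * a) * (w 0 ^ 2 + w 1 ^ 2)) := by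
    apply Real.exp_le_exp.2
    nlinarith [sq_nonneg (w 0), sq_nonneg (w 1)]
  calc |w 0| ^ i * |w 1| ^ j * Real.exp (-s * (w 0 ^ 2 + w 1 ^ 2))
      ≤ (i.factorial * Real.exp (1 / (4 * a)) * Real.exp (a * w 0 ^ 2)) *
        (j.factorial * Real.exp (1 / (4 * a)) * Real.exp (a * w 1 ^ 2)) *
        Real.exp (-(2 * a) * (w 0 ^ 2 + w 1 ^ 2)) := by
        gcongr
        · exact abs_pow_le_exp_sq ha i _
        · exact abs_pow_le_exp_sq ha j _
    _ = (i.factorial * Real.exp (1 / (4 * a))) * (j.factorial * Real.exp (1 / (4 * a))) *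
        (Real.exp (a * w 0 ^ 2) * Real.exp (a * w 1 ^ 2) *
          Real.exp (-(2 * a) * (w 0 ^ 2 + w 1 ^ 2))) := by ring
    _ = _ := by rw [← Real.exp_add, ← Real.exp_add]; ring_nf

lemma exp_neg_norm_sub_sq_le {a : ℝ} (ha : 0 < a) {x x₀ : Plane} (hx : ‖x - x₀‖ ≤ 1) (y : Plane) :
    Real.exp (-a * ‖x - y‖ ^ 2) ≤ Real.exp a * Real.exp (-(a / 2) * ‖x₀ - y‖ ^ 2) := by
  rw [← Real.exp_add]
  apply Real.exp_le_exp.2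
  have h1 : ‖x₀ - y‖ ≤ ‖x - y‖ + 1 := by
    calc ‖x₀ - y‖ = ‖(x - y) - (x - x₀)‖ := by congr 1; abel
      _ ≤ ‖x - y‖ + ‖x - x₀‖ := norm_sub_le _ _
      _ ≤ _ := by gcongr
  have h2 : ‖x₀ - y‖ ^ 2 ≤ 2 * ‖x - y‖ ^ 2 + 2 := by
    nlinarith [norm_nonneg (x₀ - y), norm_nonneg (x - y), sq_nonneg (‖x - y‖ - 1)]
  nlinarith

lemma gaussMonomial_sub_le {s₀ : ℝ} (hs₀ : 0 < s₀) (x₀ : Plane) (i j : ℕ) :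
    ∃ C : ℝ, 0 ≤ C ∧ ∀ s, s₀ / 2 ≤ s → ∀ x : Plane, ‖x - x₀‖ ≤ 1 → ∀ y,
      |gaussMonomial i j s (x - y)| ≤ C * Real.exp (-(s₀ / 8) * ‖x₀ - y‖ ^ 2) := by
  obtain ⟨C, hC, h⟩ := abs_gaussMonomial_le (a := s₀ / 4) (by positivity) i j
  refine ⟨C * Real.exp (s₀ / 4), by positivity, fun s hs x hx y => ?_⟩
  calc |gaussMonomial i j s (x - y)| ≤ C * Real.exp (-(s₀ / 4) * ‖x - y‖ ^ 2) :=
        h s (by linarith) _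
    _ ≤ C * (Real.exp (s₀ / 4) * Real.exp (-(s₀ / 4 / 2) * ‖x₀ - y‖ ^ 2)) := by
        gcongr
        exact exp_neg_norm_sub_sq_le (by positivity) hx y
    _ = _ := by rw [mul_assoc]; congr 4; ring

lemma integrable_exp_neg_norm_sq {a : ℝ} (ha : 0 < a) :
    Integrable (fun w : Plane => Real.exp (-a * ‖w‖ ^ 2)) := by
  -- A non-integrable function has Bochner integral `0`, whereas the known value of the Gaussian
  -- integral is positive.
  by_contra h
  have := GaussianFourier.integral_rexp_neg_mul_sq_norm (V := Plane) ha
  rw [integral_undef h] at this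
  have : 0 < (Real.pi / a) ^ (Module.finrank ℝ Plane / 2 : ℝ) := by positivity
  linarith

lemma integrable_exp_neg_norm_sub_sq {a : ℝ} (ha : 0 < a) (x : Plane) :
    Integrable (fun y : Plane => Real.exp (-a * ‖x - y‖ ^ 2)) :=
  (integrable_exp_neg_norm_sq ha).comp_sub_left x

lemma continuous_gaussMonomial (i j : ℕ) (s : ℝ) : Continuous (gaussMonomial i j s) := by
  unfold gaussMonomial
  fun_prop

lemma integrable_gaussMonomial_mul {f : Plane → ℝ} (hf : Measurable f) {M : ℝ}
    (hM : ∀ y, |f y| ≤ M) (i j : ℕ) {s : ℝ} (hs : 0 < s) (x : Plane) :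
    Integrable (fun y => gaussMonomial i j s (x - y) * f y) := by
  obtain ⟨C, hC, h⟩ := gaussMonomial_sub_le hs x i j
  refine Integrable.mono' (((integrable_exp_neg_norm_sub_sq
    (show 0 < s / 8 by positivity) x).const_mul C).mul_const M) ?_ (ae_of_all _ fun y => ?_)
  · exact (((continuous_gaussMonomial i j s).comp (by fun_prop)).measurable.mul
      hf).aestronglyMeasurable
  · rw [Real.norm_eq_abs, abs_mul]
    gcongr
    · exact h s (by linarith) x (by simp) y
    · exact hM y

/-- Evaluation of the `k`-th space coordinate on space-time, as a continuous linear map. -/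
def spaceProj (k : Fin 2) : ℝ × Plane →L[ℝ] ℝ :=
  (EuclideanSpace.proj k).comp (ContinuousLinearMap.snd ℝ ℝ Plane)

lemma spaceProj_apply (k : Fin 2) (p : ℝ × Plane) : spaceProj k p = p.2 k := rfl

/-- The family is closed under differentiation: this makes smoothness an induction. The truncated
exponents `i - 1` and `j - 1` are harmless at `0`, since their coefficients `i` and `j` vanish
there. -/
lemma hasFDerivAt_gaussMonomial (i j : ℕ) (y : Plane) (p : ℝ × Plane) :
    HasFDerivAt (fun p : ℝ × Plane => gaussMonomial i j p.1 (p.2 - y))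
      ((-(gaussMonomial (i + 2) j p.1 (p.2 - y) + gaussMonomial i (j + 2) p.1 (p.2 - y))) •
          ContinuousLinearMap.fst ℝ ℝ Plane +
        (i * gaussMonomial (i - 1) j p.1 (p.2 - y) -
          2 * p.1 * gaussMonomial (i + 1) j p.1 (p.2 - y)) • spaceProj 0 +
        (j * gaussMonomial i (j - 1) p.1 (p.2 - y) -
          2 * p.1 * gaussMonomial i (j + 1) p.1 (p.2 - y)) • spaceProj 1) p := by
  have h0 (k : Fin 2) : HasFDerivAt (fun p : ℝ × Plane => (p.2 - y) k) (spaceProj k) p := by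
    have : (fun p : ℝ × Plane => (p.2 - y) k) = fun p => spaceProj k p - y k := by
      ext p; simp [spaceProj_apply]
    rw [this]
    exact (spaceProj k).hasFDerivAt.sub_const _
  have hs : HasFDerivAt (fun p : ℝ × Plane => p.1) (ContinuousLinearMap.fst ℝ ℝ Plane) p :=
    hasFDerivAt_fst
  have key := (((h0 0).pow i).mul ((h0 1).pow j)).mul
    ((hs.neg.mul (((h0 0).pow 2).add ((h0 1).pow 2))).exp)
  refine key.congr_fderiv ?_
  ext v <;> simp [gaussMonomial, spaceProj_apply] <;> ring

lemma integrable_smul_add_smul_add_smul {α E : Type*} [MeasurableSpace α] {μ : Measure α}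
    [NormedAddCommGroup E] [NormedSpace ℝ E] {a b c : α → ℝ} (ha : Integrable a μ)
    (hb : Integrable b μ) (hc : Integrable c μ) (u v w : E) :
    Integrable (fun y => a y • u + b y • v + c y • w) μ :=
  ((ha.smul_const u).add (hb.smul_const v)).add (hc.smul_const w)

lemma integral_smul_add_smul_add_smul {α E : Type*} [MeasurableSpace α] {μ : Measure α}
    [NormedAddCommGroup E] [NormedSpace ℝ E] [CompleteSpace E] {a b c : α → ℝ}
    (ha : Integrable a μ) (hb : Integrable b μ) (hc : Integrable c μ) (u v w : E) :
    ∫ y, (a y • u + b y • v + c y • w) ∂μ =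
      (∫ y, a y ∂μ) • u + (∫ y, b y ∂μ) • v + (∫ y, c y ∂μ) • w := by
  have h12 : Integrable (fun y => a y • u + b y • v) μ :=
    (ha.smul_const u).add (hb.smul_const v)
  rw [integral_add h12 (hc.smul_const w), integral_add (ha.smul_const u) (hb.smul_const v),
    integral_smul_const, integral_smul_const, integral_smul_const]

lemma hasFDerivAt_gaussConv {f : Plane → ℝ} (hf : Measurable f) {M : ℝ}
    (hM : ∀ y, |f y| ≤ M) (i j : ℕ) {p : ℝ × Plane} (hp : 0 < p.1) :
    HasFDerivAt (gaussConv f i j)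
      ((-(gaussConv f (i + 2) j p + gaussConv f i (j + 2) p)) • ContinuousLinearMap.fst ℝ ℝ Plane +
        (i * gaussConv f (i - 1) j p - 2 * p.1 * gaussConv f (i + 1) j p) • spaceProj 0 +
        (j * gaussConv f i (j - 1) p - 2 * p.1 * gaussConv f i (j + 1) p) • spaceProj 1) p := by
  have hM0 : 0 ≤ M := (abs_nonneg _).trans (hM 0)
  have hinteg := fun i j => integrable_gaussMonomial_mul hf hM i j hp p.2
  let G : ℝ × Plane → Plane → ℝ × Plane →L[ℝ] ℝ := fun q y =>
    (-(gaussMonomial (i + 2) j q.1 (q.2 - y) * f y + gaussMonomial i (j + 2) q.1 (q.2 - y) * f y)) •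
        ContinuousLinearMap.fst ℝ ℝ Plane +
      (i * (gaussMonomial (i - 1) j q.1 (q.2 - y) * f y) -
        2 * q.1 * (gaussMonomial (i + 1) j q.1 (q.2 - y) * f y)) • spaceProj 0 +
      (j * (gaussMonomial i (j - 1) q.1 (q.2 - y) * f y) -
        2 * q.1 * (gaussMonomial i (j + 1) q.1 (q.2 - y) * f y)) • spaceProj 1
  have hG1 := ((hinteg (i + 2) j).add (hinteg i (j + 2))).neg
  have hG2 := ((hinteg (i - 1) j).const_mul (i : ℝ)).sub ((hinteg (i + 1) j).const_mul (2 * p.1))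
  have hG3 := ((hinteg i (j - 1)).const_mul (j : ℝ)).sub ((hinteg i (j + 1)).const_mul (2 * p.1))
  have hGint : ∫ y, G p y = (-(gaussConv f (i + 2) j p + gaussConv f i (j + 2) p)) •
        ContinuousLinearMap.fst ℝ ℝ Plane +
        (i * gaussConv f (i - 1) j p - 2 * p.1 * gaussConv f (i + 1) j p) • spaceProj 0 +
        (j * gaussConv f i (j - 1) p - 2 * p.1 * gaussConv f i (j + 1) p) • spaceProj 1 := by
    refine (integral_smul_add_smul_add_smul hG1 hG2 hG3 _ _ _).trans ?_
    simp only [Pi.neg_apply, Pi.add_apply, Pi.sub_apply]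
    rw [integral_neg, integral_add (hinteg _ _) (hinteg _ _),
      integral_sub ((hinteg _ _).const_mul _) ((hinteg _ _).const_mul _),
      integral_sub ((hinteg _ _).const_mul _) ((hinteg _ _).const_mul _)]
    simp only [integral_const_mul]
    rfl
  rw [← hGint]
  obtain ⟨A, hA, hA'⟩ := gaussMonomial_sub_le hp p.2 (i + 2) j
  obtain ⟨B, hB, hB'⟩ := gaussMonomial_sub_le hp p.2 i (j + 2)
  obtain ⟨C, hC, hC'⟩ := gaussMonomial_sub_le hp p.2 (i - 1) j
  obtain ⟨D, hD, hD'⟩ := gaussMonomial_sub_le hp p.2 (i + 1) j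
  obtain ⟨E, hE, hE'⟩ := gaussMonomial_sub_le hp p.2 i (j - 1)
  obtain ⟨F, hF, hF'⟩ := gaussMonomial_sub_le hp p.2 i (j + 1)
  -- On this neighbourhood the parameter is at least `p.1 / 2` and the point within distance `1`,
  -- which is the range of `gaussMonomial_sub_le`; the upper bound `2 * p.1` controls the explicit
  -- factors of the parameter.
  let s : Set (ℝ × Plane) := Set.Ioo (p.1 / 2) (2 * p.1) ×ˢ Metric.ball p.2 1
  have hs : s ∈ 𝓝 p := by
    refine prod_mem_nhds (Ioo_mem_nhds (by linarith) (by linarith)) (Metric.ball_mem_nhds _ one_pos)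
  let e : Plane → ℝ := fun y => Real.exp (-(p.1 / 8) * ‖p.2 - y‖ ^ 2)
  refine hasFDerivAt_integral_of_dominated_of_fderiv_le (F' := G) (s := s)
    (bound := fun y => (((A + B) * M) * ‖ContinuousLinearMap.fst ℝ ℝ Plane‖ +
      ((i * C + 2 * (2 * p.1) * D) * M) * ‖spaceProj 0‖ +
      ((j * E + 2 * (2 * p.1) * F) * M) * ‖spaceProj 1‖) * e y) hs ?_ (hinteg i j) ?_ ?_ ?_ ?_
  · refine Eventually.of_forall fun q => ?_
    exact (((continuous_gaussMonomial i j q.1).comp (by fun_prop)).measurable.mul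
      hf).aestronglyMeasurable
  · exact (integrable_smul_add_smul_add_smul hG1 hG2 hG3 _ _ _).aestronglyMeasurable
  · refine ae_of_all _ fun y q hq => ?_
    have hq1 : p.1 / 2 ≤ q.1 := hq.1.1.le
    have hq2 : q.1 ≤ 2 * p.1 := hq.1.2.le
    have hq3 : ‖q.2 - p.2‖ ≤ 1 := by
      have := hq.2
      rw [Metric.mem_ball, dist_eq_norm] at this
      exact this.le
    have hq0 : 0 ≤ q.1 := by linarith
    have T : ∀ (k l : ℕ) (K : ℝ), 0 ≤ K → (∀ s, p.1 / 2 ≤ s → ∀ x : Plane, ‖x - p.2‖ ≤ 1 → ∀ y,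
        |gaussMonomial k l s (x - y)| ≤ K * Real.exp (-(p.1 / 8) * ‖p.2 - y‖ ^ 2)) →
        |gaussMonomial k l q.1 (q.2 - y) * f y| ≤ K * M * e y := by
      intro k l K hK h
      rw [abs_mul]
      calc _ ≤ (K * e y) * M := by
            gcongr
            · exact h _ hq1 _ hq3 y
            · exact hM y
        _ = _ := by ring
    have n1 := T _ _ _ hA hA'
    have n2 := T _ _ _ hB hB'
    have n3 := T _ _ _ hC hC'
    have n4 := T _ _ _ hD hD'
    have n5 := T _ _ _ hE hE'
    have n6 := T _ _ _ hF hF'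
    have S : ∀ (k : ℕ) (a b K K' : ℝ), 0 ≤ K' → |a| ≤ K * M * e y → |b| ≤ K' * M * e y →
        ‖(k : ℝ) * a - 2 * q.1 * b‖ ≤ (k * K + 2 * (2 * p.1) * K') * M * e y := by
      intro k a b K K' hK' ha hb
      have he : 0 < e y := Real.exp_pos _
      calc ‖(k : ℝ) * a - 2 * q.1 * b‖ ≤ ‖(k : ℝ) * a‖ + ‖2 * q.1 * b‖ := norm_sub_le _ _
        _ = k * |a| + 2 * q.1 * |b| := by
          rw [norm_mul, norm_mul, Real.norm_eq_abs, Real.norm_eq_abs, Real.norm_eq_abs,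
            Real.norm_eq_abs, abs_of_nonneg (show 0 ≤ 2 * q.1 by linarith), Nat.abs_cast]
        _ ≤ k * (K * M * e y) + 2 * (2 * p.1) * (K' * M * e y) := by gcongr
        _ = _ := by ring
    calc ‖G q y‖ ≤ ((A + B) * M * e y) * ‖ContinuousLinearMap.fst ℝ ℝ Plane‖ +
      ((i * C + 2 * (2 * p.1) * D) * M * e y) * ‖spaceProj 0‖ +
      ((j * E + 2 * (2 * p.1) * F) * M * e y) * ‖spaceProj 1‖ := by
          refine norm_add_le_of_le (norm_add_le_of_le ?_ ?_) ?_
          · rw [norm_smul, norm_neg]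
            gcongr
            refine (norm_add_le _ _).trans ?_
            rw [Real.norm_eq_abs, Real.norm_eq_abs]
            linarith
          · rw [norm_smul]
            gcongr
            exact S _ _ _ _ _ hD n3 n4
          · rw [norm_smul]
            gcongr
            exact S _ _ _ _ _ hF n5 n6
      _ = _ := by ring
  · exact (integrable_exp_neg_norm_sub_sq (by linarith) p.2).const_mul _
  · refine ae_of_all _ fun y q _ => ?_
    refine ((hasFDerivAt_gaussMonomial i j y q).mul_const (f y)).congr_fderiv ?_
    ext v <;> simp [G] <;> ring

lemma contDiffOn_gaussConv {f : Plane → ℝ} (hf : Measurable f) {M : ℝ}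
    (hM : ∀ y, |f y| ≤ M) (n : ℕ) (i j : ℕ) :
    ContDiffOn ℝ n (gaussConv f i j) (Set.Ioi 0 ×ˢ Set.univ) := by
  have ho : IsOpen (Set.Ioi (0 : ℝ) ×ˢ (Set.univ : Set Plane)) := isOpen_Ioi.prod isOpen_univ
  induction n generalizing i j with
  | zero =>
    exact contDiffOn_zero.2 fun p hp =>
      (hasFDerivAt_gaussConv hf hM i j hp.1).continuousAt.continuousWithinAt
  | succ n ih =>
    rw [Nat.cast_succ, contDiffOn_succ_iff_fderiv_of_isOpen ho]
    refine ⟨fun p hp => (hasFDerivAt_gaussConv hf hM i j hp.1).differentiableAt.differentiableWithinAt,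
      by simp, ?_⟩
    refine ContDiffOn.congr ?_ fun p hp => (hasFDerivAt_gaussConv hf hM i j hp.1).fderiv
    have h1 : ContDiffOn ℝ n (fun p : ℝ × Plane => 2 * p.1) (Set.Ioi 0 ×ˢ Set.univ) := by
      fun_prop
    refine ContDiffOn.add (ContDiffOn.add ?_ ?_) ?_
    · exact ((ih _ _).add (ih _ _)).neg.smul contDiffOn_const
    · exact ((contDiffOn_const.mul (ih _ _)).sub (h1.mul (ih _ _))).smul contDiffOn_const
    · exact ((contDiffOn_const.mul (ih _ _)).sub (h1.mul (ih _ _))).smul contDiffOn_const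

/-! ### The free heat flow in the plane. -/

/-- The density of the standard heat kernel at time one. -/
def heatWeight (z : Plane) : ℝ := (4 * Real.pi)⁻¹ * Real.exp (-(1 / 4) * ‖z‖ ^ 2)

/-- The free heat flow at time `t` starting from `f`. -/
def heatFlow (f : Plane → ℝ) (t : ℝ) (x : Plane) : ℝ :=
  ∫ z, heatWeight z * f (x + √t • z)

lemma heatWeight_pos (z : Plane) : 0 < heatWeight z := by
  unfold heatWeight; positivity

lemma continuous_heatWeight : Continuous heatWeight := by
  unfold heatWeight; fun_prop

lemma integrable_heatWeight : Integrable heatWeight :=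
  (integrable_exp_neg_norm_sq (by norm_num)).const_mul _

lemma integral_heatWeight : ∫ z, heatWeight z = 1 := by
  unfold heatWeight
  rw [integral_const_mul, GaussianFourier.integral_rexp_neg_mul_sq_norm (V := Plane) (by norm_num)]
  simp
  field_simp

lemma heatFlow_zero (f : Plane → ℝ) (x : Plane) : heatFlow f 0 x = f x := by
  simp [heatFlow, integral_mul_const, integral_heatWeight]

/-- Substitution `y = x + √t z`, with Jacobian `t` in the plane. The convolution form gives
smoothness for `t > 0`, while the averaged form makes sense at `t = 0` and gives the bounds and the
limits there. -/
lemma heatFlow_eq_gaussConv (f : Plane → ℝ) {t : ℝ} (ht : 0 < t) (x : Plane) :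
    heatFlow f t x = (4 * t)⁻¹ / Real.pi * gaussConv f 0 0 ((4 * t)⁻¹, x) := by
  have hs : 0 < √t := Real.sqrt_pos.2 ht
  let g : Plane → ℝ := fun w => heatWeight ((√t)⁻¹ • w) * f (x + w)
  have h1 : heatFlow f t x = ∫ z, g (√t • z) := by
    unfold heatFlow
    congr 1; ext z
    simp [g, smul_smul, hs.ne']
  have h2 : ∫ w, g w = ∫ y, g (y - x) := (integral_sub_right_eq_self g x).symm
  rw [h1, Measure.integral_comp_smul, h2, smul_eq_mul]
  simp only [finrank_euclideanSpace, Fintype.card_fin, Real.sq_sqrt ht.le]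
  rw [abs_of_pos (inv_pos.2 ht)]
  unfold gaussConv
  rw [← integral_const_mul, ← integral_const_mul]
  congr 1; ext y
  simp only [g, heatWeight, gaussMonomial, add_sub_cancel, pow_zero, one_mul, norm_smul]
  rw [← Plane.norm_sq, norm_sub_rev x y, mul_pow, norm_inv, Real.norm_eq_abs, abs_of_pos hs,
    inv_pow, Real.sq_sqrt ht.le]
  have : -(1 / 4) * (t⁻¹ * ‖y - x‖ ^ 2) = -(4 * t)⁻¹ * ‖y - x‖ ^ 2 := by
    field_simp
  rw [this]
  field_simp

lemma integrable_heatWeight_mul {f : Plane → ℝ} (hf : Measurable f) {M : ℝ}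
    (hM : ∀ y, |f y| ≤ M) (t : ℝ) (x : Plane) :
    Integrable (fun z => heatWeight z * f (x + √t • z)) := by
  refine (integrable_heatWeight.mul_const M).mono' ?_ (ae_of_all _ fun z => ?_)
  · exact (continuous_heatWeight.measurable.mul
      (hf.comp (by fun_prop))).aestronglyMeasurable
  · rw [Real.norm_eq_abs, abs_mul, abs_of_pos (heatWeight_pos z)]
    exact mul_le_mul_of_nonneg_left (hM _) (heatWeight_pos z).le

lemma abs_heatFlow_le {f : Plane → ℝ} {M : ℝ}
    (hM : ∀ y, |f y| ≤ M) (t : ℝ) (x : Plane) : |heatFlow f t x| ≤ M := by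
  have := norm_integral_le_of_norm_le (f := fun z => heatWeight z * f (x + √t • z))
    (integrable_heatWeight.mul_const M) (ae_of_all _ fun z => by
      rw [Real.norm_eq_abs, abs_mul, abs_of_pos (heatWeight_pos z)]
      exact mul_le_mul_of_nonneg_left (hM _) (heatWeight_pos z).le)
  rwa [integral_mul_const, integral_heatWeight, one_mul] at this

lemma heatFlow_nonneg {f : Plane → ℝ} (hf : ∀ y, 0 ≤ f y) (t : ℝ) (x : Plane) :
    0 ≤ heatFlow f t x :=
  integral_nonneg fun z => mul_nonneg (heatWeight_pos z).le (hf _)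

/-- The heat kernel is at most `1/(4πt)`. This `L¹` to `L^∞` bound is the source of uniqueness,
where the data are small only in `L¹`. -/
lemma heatFlow_le_integral {f : Plane → ℝ} (hf : ∀ y, 0 ≤ f y) (hi : Integrable f) {t : ℝ}
    (ht : 0 < t) (x : Plane) : heatFlow f t x ≤ (4 * t)⁻¹ / Real.pi * ∫ y, f y := by
  rw [heatFlow_eq_gaussConv f ht x]
  gcongr
  refine integral_mono_of_nonneg (ae_of_all _ fun y => ?_) hi (ae_of_all _ fun y => ?_)
  · exact mul_nonneg (by simp [gaussMonomial]; positivity) (hf y)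
  · refine mul_le_of_le_one_left (hf y) ?_
    simp only [gaussMonomial, pow_zero, one_mul]
    apply Real.exp_le_one_iff.2
    rw [neg_mul]
    exact neg_nonpos.2 (by positivity)

lemma heatFlow_comp_isometry (f : Plane → ℝ) (φ : Plane ≃ᵃⁱ[ℝ] Plane) (t : ℝ) (x : Plane) :
    heatFlow (fun y => f (φ y)) t x = heatFlow f t (φ x) := by
  unfold heatFlow
  rw [← (φ.linearIsometryEquiv.measurePreserving).integral_comp
    φ.linearIsometryEquiv.toHomeomorph.measurableEmbedding
    (fun z => heatWeight z * f (φ x + √t • z))]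
  congr 1; ext z
  have : φ (x + √t • z) = φ x + √t • φ.linearIsometryEquiv z := by
    have := φ.map_vadd x (√t • z)
    rw [vadd_eq_add, vadd_eq_add, map_smul] at this
    rw [add_comm x, this, add_comm]
  simp [heatWeight, this]

lemma tendsto_heatFlow {f : Plane → ℝ} (hf : Measurable f) {M : ℝ}
    (hM : ∀ y, |f y| ≤ M) {x : Plane} (hx : ContinuousAt f x) :
    Tendsto (fun t => heatFlow f t x) (𝓝[>] 0) (𝓝 (f x)) := by
  have h := tendsto_integral_filter_of_dominated_convergence (μ := volume) (l := 𝓝[>] (0 : ℝ))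
    (F := fun t z => heatWeight z * f (x + √t • z)) (f := fun z => heatWeight z * f x)
    (fun z => heatWeight z * M)
    (Eventually.of_forall fun t => (integrable_heatWeight_mul hf hM t x).aestronglyMeasurable)
    (Eventually.of_forall fun t => ae_of_all _ fun z => by
      rw [Real.norm_eq_abs, abs_mul, abs_of_pos (heatWeight_pos z)]
      exact mul_le_mul_of_nonneg_left (hM _) (heatWeight_pos z).le)
    (integrable_heatWeight.mul_const M)
    (ae_of_all _ fun z => by
      refine Tendsto.const_mul _ ?_
      have hc : Tendsto (fun t : ℝ => x + √t • z) (𝓝[>] 0) (𝓝 x) := by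
        have : Continuous fun t : ℝ => x + √t • z := by fun_prop
        have h0 := this.tendsto 0
        simp only [Real.sqrt_zero, zero_smul, add_zero] at h0
        exact h0.mono_left nhdsWithin_le_nhds
      exact hx.tendsto.comp hc)
  rwa [integral_mul_const, integral_heatWeight, one_mul] at h

lemma continuous_heatFlow {f : Plane → ℝ} (hf : Continuous f) {M : ℝ}
    (hM : ∀ y, |f y| ≤ M) : Continuous (fun p : ℝ × Plane => heatFlow f p.1 p.2) := by
  refine continuous_of_dominated (bound := fun z => heatWeight z * M)
    (fun p => (integrable_heatWeight_mul hf.measurable hM p.1 p.2).aestronglyMeasurable)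
    (fun p => ae_of_all _ fun z => ?_) (integrable_heatWeight.mul_const M)
    (ae_of_all _ fun z => by fun_prop)
  rw [Real.norm_eq_abs, abs_mul, abs_of_pos (heatWeight_pos z)]
  exact mul_le_mul_of_nonneg_left (hM _) (heatWeight_pos z).le

lemma contDiffOn_heatFlow {f : Plane → ℝ} (hf : Measurable f) {M : ℝ}
    (hM : ∀ y, |f y| ≤ M) (n : ℕ) :
    ContDiffOn ℝ n (fun p : ℝ × Plane => heatFlow f p.1 p.2) (Set.Ioi 0 ×ˢ Set.univ) := by
  have h1 : ContDiffOn ℝ n (fun p : ℝ × Plane => (4 * p.1)⁻¹) (Set.Ioi 0 ×ˢ Set.univ) :=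
    ContDiffOn.inv (by fun_prop) fun p hp => by
      have : 0 < p.1 := hp.1
      positivity
  have h2 : ContDiffOn ℝ n (fun p : ℝ × Plane => gaussConv f 0 0 ((4 * p.1)⁻¹, p.2))
      (Set.Ioi 0 ×ˢ Set.univ) :=
    (contDiffOn_gaussConv hf hM n 0 0).comp (h1.prodMk contDiffOn_snd) fun p hp => by
      have : 0 < p.1 := hp.1
      exact ⟨by simpa using this, trivial⟩
  exact ((h1.div_const Real.pi).mul h2).congr fun p hp => heatFlow_eq_gaussConv f hp.1 p.2

lemma continuous_heatFlow_space {f : Plane → ℝ} (hf : Measurable f) {M : ℝ}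
    (hM : ∀ y, |f y| ≤ M) {t : ℝ} (ht : 0 < t) : Continuous (heatFlow f t) := by
  have h1 := (contDiffOn_heatFlow hf hM 0).continuousOn
  have h2 : ContinuousOn (fun y : Plane => ((t, y) : ℝ × Plane)) Set.univ := by fun_prop
  exact continuousOn_univ.1 (h1.comp h2 fun y _ => ⟨ht, trivial⟩)

lemma hasFDerivAt_gaussConv_space {f : Plane → ℝ} (hf : Measurable f) {M : ℝ}
    (hM : ∀ y, |f y| ≤ M) (i j : ℕ) {s : ℝ} (hs : 0 < s) (x : Plane) :
    HasFDerivAt (fun x => gaussConv f i j (s, x))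
      ((i * gaussConv f (i - 1) j (s, x) - 2 * s * gaussConv f (i + 1) j (s, x)) •
          (EuclideanSpace.proj 0 : Plane →L[ℝ] ℝ) +
        (j * gaussConv f i (j - 1) (s, x) - 2 * s * gaussConv f i (j + 1) (s, x)) •
          (EuclideanSpace.proj 1 : Plane →L[ℝ] ℝ)) x := by
  have h := (hasFDerivAt_gaussConv hf hM i j (p := (s, x)) hs).comp x (hasFDerivAt_prodMk_right s x)
  refine h.congr_fderiv ?_
  ext v
  simp [spaceProj_apply]

lemma hasDerivAt_gaussConv_time {f : Plane → ℝ} (hf : Measurable f) {M : ℝ}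
    (hM : ∀ y, |f y| ≤ M) (i j : ℕ) {s : ℝ} (hs : 0 < s) (x : Plane) :
    HasDerivAt (fun s => gaussConv f i j (s, x))
      (-(gaussConv f (i + 2) j (s, x) + gaussConv f i (j + 2) (s, x))) s := by
  have h := ((hasFDerivAt_gaussConv hf hM i j (p := (s, x)) hs).comp s
    (hasFDerivAt_prodMk_left s x)).hasDerivAt
  refine h.congr_deriv ?_
  simp [spaceProj_apply]

lemma laplacian_eq_fderiv_fderiv (v : Plane → ℝ) (x : Plane) :
    Laplacian.laplacian v x =
      fderiv ℝ (fderiv ℝ v) x (EuclideanSpace.single 0 1) (EuclideanSpace.single 0 1) +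
      fderiv ℝ (fderiv ℝ v) x (EuclideanSpace.single 1 1) (EuclideanSpace.single 1 1) := by
  rw [InnerProductSpace.laplacian_eq_iteratedFDeriv_orthonormalBasis v
    (EuclideanSpace.basisFun (Fin 2) ℝ)]
  simp [Fin.sum_univ_two, iteratedFDeriv_two_apply]

/-- Expressed through Gaussian moments of orders zero and two, so that it can be matched with the
time derivative in `hasDerivAt_heatFlow`. -/
lemma laplacian_heatFlow {f : Plane → ℝ} (hf : Measurable f) {M : ℝ}
    (hM : ∀ y, |f y| ≤ M) {t : ℝ} (ht : 0 < t) (x : Plane) :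
    Laplacian.laplacian (heatFlow f t) x = (4 * t)⁻¹ / Real.pi *
      (-4 * (4 * t)⁻¹ * gaussConv f 0 0 ((4 * t)⁻¹, x) +
        4 * (4 * t)⁻¹ ^ 2 *
          (gaussConv f 2 0 ((4 * t)⁻¹, x) + gaussConv f 0 2 ((4 * t)⁻¹, x))) := by
  have hs : 0 < (4 * t)⁻¹ := by positivity
  rw [show heatFlow f t = fun x => _ from funext fun x => heatFlow_eq_gaussConv f ht x]
  set s := (4 * t)⁻¹
  have h1 : fderiv ℝ (fun x => s / Real.pi * gaussConv f 0 0 (s, x)) = fun x => (s / Real.pi) •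
      ((-2 * s * gaussConv f 1 0 (s, x)) • (EuclideanSpace.proj 0 : Plane →L[ℝ] ℝ) +
        (-2 * s * gaussConv f 0 1 (s, x)) • (EuclideanSpace.proj 1 : Plane →L[ℝ] ℝ)) := by
    ext1 x
    refine (((hasFDerivAt_gaussConv_space hf hM 0 0 hs x).const_mul (s / Real.pi))).fderiv.trans ?_
    simp
  have h2 := ((((hasFDerivAt_gaussConv_space hf hM 1 0 hs x).const_mul (-2 * s)).smul_const
      (EuclideanSpace.proj 0 : Plane →L[ℝ] ℝ)).add
      (((hasFDerivAt_gaussConv_space hf hM 0 1 hs x).const_mul (-2 * s)).smul_const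
      (EuclideanSpace.proj 1 : Plane →L[ℝ] ℝ))).const_smul (s / Real.pi)
  have h3 := HasFDerivAt.fderiv h2
  rw [laplacian_eq_fderiv_fderiv, h1]
  erw [h3]
  simp
  ring

lemma hasDerivAt_heatFlow {f : Plane → ℝ} (hf : Measurable f) {M : ℝ}
    (hM : ∀ y, |f y| ≤ M) {t : ℝ} (ht : 0 < t) (x : Plane) :
    HasDerivAt (fun s => heatFlow f s x) (Laplacian.laplacian (heatFlow f t) x) t := by
  rw [laplacian_heatFlow hf hM ht]
  have hs : 0 < (4 * t)⁻¹ := by positivity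
  have h1 : HasDerivAt (fun t : ℝ => (4 * t)⁻¹) (-4 * (4 * t)⁻¹ ^ 2) t := by
    refine (((hasDerivAt_id t).const_mul 4).inv (by simpa using ht.ne')).congr_deriv ?_
    simp
    field_simp
  have h2 := (h1.div_const Real.pi).mul ((hasDerivAt_gaussConv_time hf hM 0 0 hs x).comp t h1)
  refine (h2.congr_deriv ?_).congr_of_eventuallyEq ?_
  · simp
    ring
  · filter_upwards [lt_mem_nhds ht] with r hr
    exact heatFlow_eq_gaussConv f hr x

/-- The free heat flow of a bounded extension of the initial temperature `1` solves the
Dirichlet problem as soon as it vanishes on the boundary. -/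
lemma isDirichletHeatSolution_heatFlow {Ω : Set Plane} (hΩ : IsOpen Ω) {f : Plane → ℝ}
    (hf : Measurable f) {M : ℝ} (hM : ∀ y, |f y| ≤ M) (h1 : ∀ x ∈ Ω, f x = 1)
    (hb : ∀ t : ℝ, 0 < t → ∀ x ∈ frontier Ω, heatFlow f t x = 0) :
    IsDirichletHeatSolution Ω (heatFlow f) where
  contDiffOn := (contDiffOn_heatFlow hf hM 2).mono (Set.prod_mono_right (Set.subset_univ _))
  continuousOn := (contDiffOn_heatFlow hf hM 2).continuousOn.mono
    (Set.prod_mono_right (Set.subset_univ _))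
  heat_eq := fun _ ht x _ => hasDerivAt_heatFlow hf hM ht x
  boundary := hb
  initial := fun x hx => by
    have hc : ContinuousAt f x :=
      (continuousAt_const (y := (1 : ℝ))).congr
        (Filter.mem_of_superset (hΩ.mem_nhds hx) fun y hy => (h1 y hy).symm)
    simpa [h1 x hx] using tendsto_heatFlow hf hM hc
  bounded := ⟨M, fun t _ x _ => abs_heatFlow_le hM t x⟩

/-! ### Maximum principle and uniqueness. -/

/-- Were the second derivative positive, the point would also be a local minimum, so `g` would be
locally constant and its second derivative zero. -/
lemma deriv_deriv_nonpos_of_isLocalMax {g : ℝ → ℝ} {a : ℝ} (hg : IsLocalMax g a)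
    (hc : ContinuousAt g a) : deriv (deriv g) a ≤ 0 := by
  by_contra! h
  have hmin := isLocalMin_of_deriv_deriv_pos h hg.deriv_eq_zero hc
  have hconst : g =ᶠ[𝓝 a] fun _ => g a := by
    filter_upwards [hg, hmin] with y h1 h2
    exact le_antisymm h1 h2
  have h0 : deriv g =ᶠ[𝓝 a] fun _ => 0 := by
    refine hconst.deriv.trans ?_
    simp
  rw [h0.deriv_eq] at h
  simp at h

lemma fderiv_fderiv_nonpos_of_isLocalMax {v : Plane → ℝ} {x : Plane} (hv : IsLocalMax v x)
    (hd : ContDiffAt ℝ 2 v x) (e : Plane) : fderiv ℝ (fderiv ℝ v) x e e ≤ 0 := by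
  have hl : ∀ r : ℝ, HasDerivAt (fun r : ℝ => x + r • e) e r := fun r => by
    simpa using ((hasDerivAt_id r).smul_const e).const_add x
  have hx0 : x + (0 : ℝ) • e = x := by simp
  have hlc : Tendsto (fun r : ℝ => x + r • e) (𝓝 0) (𝓝 x) := by
    simpa using (hl 0).continuousAt.tendsto
  let g : ℝ → ℝ := fun r => v (x + r • e)
  have hev : ∀ᶠ y in 𝓝 x, DifferentiableAt ℝ v y := by
    filter_upwards [hd.eventually (by simp)] with y hy
    exact hy.differentiableAt (by simp)
  have h1 : deriv g =ᶠ[𝓝 0] fun r => fderiv ℝ v (x + r • e) e := by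
    filter_upwards [hlc.eventually hev] with r hr
    exact (hr.hasFDerivAt.comp_hasDerivAt r (hl r)).deriv
  have h2 : HasDerivAt (fun r : ℝ => fderiv ℝ v (x + r • e) e) (fderiv ℝ (fderiv ℝ v) x e e) 0 := by
    have hdd : DifferentiableAt ℝ (fderiv ℝ v) x :=
      (hd.fderiv_right (m := 1) (by norm_num)).differentiableAt (by simp)
    have h3 : HasFDerivAt (fderiv ℝ v) (fderiv ℝ (fderiv ℝ v) x) (x + (0 : ℝ) • e) := by
      rw [hx0]; exact hdd.hasFDerivAt
    have h4 := h3.comp_hasDerivAt (0 : ℝ) (hl 0)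
    simpa using h4.clm_apply (hasDerivAt_const 0 e)
  have hg : IsLocalMax g 0 := by
    have : ∀ᶠ r in 𝓝 (0 : ℝ), v (x + r • e) ≤ v x := hlc.eventually hv
    simpa [IsLocalMax, IsMaxFilter, g] using this
  have hgc : ContinuousAt g 0 := by
    have : ContinuousAt v (x + (0 : ℝ) • e) := by rw [hx0]; exact hd.continuousAt
    exact ContinuousAt.comp (f := fun r : ℝ => x + r • e) this (hl 0).continuousAt
  have := deriv_deriv_nonpos_of_isLocalMax hg hgc
  rwa [h1.deriv_eq, h2.deriv] at this

lemma laplacian_nonpos_of_isLocalMax {v : Plane → ℝ} {x : Plane} (hv : IsLocalMax v x)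
    (hd : ContDiffAt ℝ 2 v x) : Laplacian.laplacian v x ≤ 0 := by
  rw [laplacian_eq_fderiv_fderiv]
  exact add_nonpos (fderiv_fderiv_nonpos_of_isLocalMax hv hd _)
    (fderiv_fderiv_nonpos_of_isLocalMax hv hd _)

/-- Only the left side is compared because the maximum over a closed time interval may be attained
at its final time. -/
lemma nonneg_of_hasDerivAt_of_le_left {g : ℝ → ℝ} {g' a b : ℝ} (hab : a < b)
    (hg : HasDerivAt g g' b) (hle : ∀ r ∈ Set.Icc a b, g r ≤ g b) : 0 ≤ g' := by
  have h1 : Tendsto (slope g b) (𝓝[<] b) (𝓝 g') :=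
    (hasDerivAt_iff_tendsto_slope.1 hg).mono_left
      (nhdsWithin_mono _ fun y hy => (ne_of_lt hy : y ≠ b))
  refine ge_of_tendsto h1 ?_
  filter_upwards [Ioo_mem_nhdsLT hab] with r hr
  rw [slope_def_field]
  exact div_nonneg_of_nonpos (sub_nonpos.2 (hle r ⟨hr.1.le, hr.2.le⟩)) (sub_nonpos.2 hr.2.le)

/-- The weak maximum principle for the heat equation on a bounded open set. -/
theorem heat_maximum_principle {Ω : Set Plane} (hΩ : IsOpen Ω) (hb : Bornology.IsBounded Ω)
    {a b : ℝ} {w : ℝ → Plane → ℝ}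
    (hc : ContinuousOn (fun p : ℝ × Plane => w p.1 p.2) (Set.Icc a b ×ˢ closure Ω))
    (hd : ∀ t ∈ Set.Ioc a b, ∀ x ∈ Ω, ContDiffAt ℝ 2 (w t) x)
    (hh : ∀ t ∈ Set.Ioc a b, ∀ x ∈ Ω,
      HasDerivAt (fun s => w s x) (Laplacian.laplacian (w t) x) t)
    (hi : ∀ x ∈ closure Ω, w a x ≤ 0) (hf : ∀ t ∈ Set.Icc a b, ∀ x ∈ frontier Ω, w t x ≤ 0)
    {t : ℝ} (ht : t ∈ Set.Icc a b) {x : Plane} (hx : x ∈ closure Ω) : w t x ≤ 0 := by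
  by_contra! hpos
  have hta : a < t := by
    rcases ht.1.lt_or_eq with h | h
    · exact h
    · exact absurd hpos (by rw [← h]; exact not_lt.2 (hi x hx))
  -- The penalty `δ * (t - a)` makes the inequality at the maximum strict; `δ` is small enough that
  -- the penalized function is still positive at `(t, x)`. A maximum point then lies neither at the
  -- initial time nor on the frontier.
  obtain ⟨δ, hδ, hδ'⟩ : ∃ δ > 0, δ * (b - a) < w t x := by
    refine ⟨w t x / (2 * (b - a)), ?_, ?_⟩
    · have : 0 < b - a := by linarith [ht.2]
      positivity
    · have : 0 < b - a := by linarith [ht.2]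
      field_simp
      linarith
  have hK : IsCompact (Set.Icc a b ×ˢ closure Ω) := isCompact_Icc.prod hb.isCompact_closure
  have hvc : ContinuousOn (fun p : ℝ × Plane => w p.1 p.2 - δ * (p.1 - a))
      (Set.Icc a b ×ˢ closure Ω) := hc.sub (by fun_prop)
  obtain ⟨⟨t₀, x₀⟩, ⟨ht₀, hx₀⟩, hmax⟩ := hK.exists_isMaxOn ⟨(t, x), ht, hx⟩ hvc
  simp only at ht₀ hx₀
  have hm : ∀ r ∈ Set.Icc a b, ∀ y ∈ closure Ω, w r y - δ * (r - a) ≤ w t₀ x₀ - δ * (t₀ - a) :=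
    fun r hr y hy => hmax (show (r, y) ∈ _ from ⟨hr, hy⟩)
  have hw0 : 0 < w t₀ x₀ := by
    have h1 := hm t ht x hx
    have h2 : δ * (t - a) ≤ δ * (b - a) := by gcongr; exact ht.2
    have h3 : 0 ≤ δ * (t₀ - a) := mul_nonneg hδ.le (by linarith [ht₀.1])
    linarith
  have ht₀a : a < t₀ := by
    rcases ht₀.1.lt_or_eq with h | h
    · exact h
    · exact absurd hw0 (by rw [← h]; exact not_lt.2 (hi x₀ hx₀))
  have hx₀Ω : x₀ ∈ Ω := by
    by_contra hn
    have : x₀ ∈ frontier Ω := by rw [hΩ.frontier_eq]; exact ⟨hx₀, hn⟩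
    exact absurd hw0 (not_lt.2 (hf t₀ ht₀ x₀ this))
  have hlm : IsLocalMax (w t₀) x₀ := by
    filter_upwards [hΩ.mem_nhds hx₀Ω] with y hy
    have := hm t₀ ht₀ y (subset_closure hy)
    linarith
  -- At the maximum the Laplacian is at most `0`, while the time derivative, which equals the
  -- Laplacian, is at least `δ > 0`.
  have hΔ := laplacian_nonpos_of_isLocalMax hlm (hd t₀ ⟨ht₀a, ht₀.2⟩ x₀ hx₀Ω)
  have hder : HasDerivAt (fun r => w r x₀ - δ * (r - a))
      (Laplacian.laplacian (w t₀) x₀ - δ) t₀ := by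
    have := (hh t₀ ⟨ht₀a, ht₀.2⟩ x₀ hx₀Ω).sub
      (((hasDerivAt_id t₀).sub_const a).const_mul δ)
    exact this.congr_deriv (by simp)
  have := nonneg_of_hasDerivAt_of_le_left ht₀a hder
    fun r hr => hm r ⟨hr.1, hr.2.trans ht₀.2⟩ x₀ hx₀
  linarith

/-- Extension by zero preserves joint continuity for functions vanishing on the boundary. -/
lemma continuousOn_indicator_of_frontier {Ω : Set Plane} (hΩ : IsOpen Ω) {w : ℝ → Plane → ℝ}
    (hc : ContinuousOn (fun p : ℝ × Plane => w p.1 p.2) (Set.Ioi 0 ×ˢ closure Ω))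
    (hf : ∀ t : ℝ, 0 < t → ∀ x ∈ frontier Ω, w t x = 0) :
    ContinuousOn (fun p : ℝ × Plane => Ω.indicator (w p.1) p.2) (Set.Ioi 0 ×ˢ Set.univ) := by
  classical
  -- Gluing along `closure Ω` rather than `Ω` uses continuity exactly where it is assumed; the two
  -- extensions agree because the function vanishes on the frontier.
  have hcl : ContinuousOn ((Set.univ ×ˢ closure Ω).piecewise (fun p : ℝ × Plane => w p.1 p.2)
      (fun _ => 0)) (Set.Ioi 0 ×ˢ Set.univ) := by
    refine ContinuousOn.piecewise ?_ (hc.mono ?_) continuousOn_const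
    · rintro ⟨t, x⟩ ⟨ht, hx⟩
      rw [frontier_univ_prod_eq] at hx
      exact hf t ht.1 x (frontier_closure_subset hx.2)
    · rintro ⟨t, x⟩ ⟨ht, hx⟩
      rw [closure_prod_eq, closure_closure] at hx
      exact ⟨ht.1, hx.2⟩
  refine hcl.congr ?_
  rintro ⟨t, x⟩ ⟨ht, -⟩
  simp only [Set.piecewise, Set.mem_prod, Set.mem_univ, true_and, Set.indicator]
  by_cases h1 : x ∈ Ω
  · simp [h1, subset_closure h1]
  · by_cases h2 : x ∈ closure Ω
    · simp only [h1, h2, if_true, if_false]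
      exact (hf t ht x (by rw [hΩ.frontier_eq]; exact ⟨h2, h1⟩)).symm
    · simp [h1, h2]

namespace IsDirichletHeatSolution

variable {Ω : Set Plane} {u v : ℝ → Plane → ℝ}

lemma contDiffAt_space (hu : IsDirichletHeatSolution Ω u) (hΩ : IsOpen Ω) {t : ℝ} (ht : 0 < t)
    {x : Plane} (hx : x ∈ Ω) : ContDiffAt ℝ 2 (u t) x := by
  have h1 : ContDiffAt ℝ 2 (fun p : ℝ × Plane => u p.1 p.2) (t, x) :=
    hu.contDiffOn.contDiffAt ((isOpen_Ioi.prod hΩ).mem_nhds ⟨ht, hx⟩)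
  exact h1.comp x (contDiffAt_const.prodMk contDiffAt_id)

/-- The free flow of a nonnegative majorant of `u - v` at time `ε` is a barrier: it dominates at
time `ε` by hypothesis and on the frontier because it is nonnegative. -/
lemma sub_le_heatFlow (hu : IsDirichletHeatSolution Ω u) (hv : IsDirichletHeatSolution Ω v)
    (hΩ : IsOpen Ω) (hb : Bornology.IsBounded Ω) {ε t : ℝ} (hε : 0 < ε) (ht : ε ≤ t)
    {h : Plane → ℝ} (hh : Continuous h) {M : ℝ} (hM : ∀ y, |h y| ≤ M) (h0 : ∀ y, 0 ≤ h y)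
    (hle : ∀ y ∈ closure Ω, u ε y - v ε y ≤ h y) {x : Plane} (hx : x ∈ Ω) :
    u t x - v t x ≤ heatFlow h (t - ε) x := by
  have hV := continuous_heatFlow hh hM
  have hVd : ∀ r, 0 < r → ∀ y, ContDiffAt ℝ 2 (heatFlow h r) y := fun r hr y => by
    have h1 : ContDiffAt ℝ 2 (fun p : ℝ × Plane => heatFlow h p.1 p.2) (r, y) :=
      (contDiffOn_heatFlow hh.measurable hM 2).contDiffAt
        ((isOpen_Ioi.prod isOpen_univ).mem_nhds ⟨hr, trivial⟩)
    exact h1.comp y (contDiffAt_const.prodMk contDiffAt_id)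
  have key := heat_maximum_principle hΩ hb (a := ε) (b := t)
    (w := fun r => (u r - v r) - heatFlow h (r - ε)) ?_ ?_ ?_ ?_ ?_
    (Set.right_mem_Icc.2 ht) (subset_closure hx)
  · simpa using key
  · have hsub : Set.Icc ε t ×ˢ closure Ω ⊆ Set.Ioi 0 ×ˢ closure Ω :=
      Set.prod_mono_left fun r hr => hε.trans_le hr.1
    refine ((hu.continuousOn.mono hsub).sub (hv.continuousOn.mono hsub)).sub ?_
    exact (hV.comp (by fun_prop : Continuous fun p : ℝ × Plane => (p.1 - ε, p.2))).continuousOn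
  · intro r hr y hy
    have hr0 : 0 < r := hε.trans hr.1
    exact ((hu.contDiffAt_space hΩ hr0 hy).sub (hv.contDiffAt_space hΩ hr0 hy)).sub
      (hVd _ (sub_pos.2 hr.1) y)
  · intro r hr y hy
    have hr0 : 0 < r := hε.trans hr.1
    have hu' := hu.contDiffAt_space hΩ hr0 hy
    have hv' := hv.contDiffAt_space hΩ hr0 hy
    have huv' : ContDiffAt ℝ 2 (u r - v r) y := hu'.sub hv'
    rw [huv'.laplacian_sub (hVd _ (sub_pos.2 hr.1) y), hu'.laplacian_sub hv']
    exact ((hu.heat_eq r hr0 y hy).sub (hv.heat_eq r hr0 y hy)).sub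
      ((hasDerivAt_heatFlow hh.measurable hM (sub_pos.2 hr.1) y).comp_sub_const r ε)
  · intro y hy
    simpa [heatFlow_zero] using hle y hy
  · intro r hr y hy
    have hr0 : 0 < r := hε.trans_le hr.1
    simp only [Pi.sub_apply, hu.boundary r hr0 y hy, hv.boundary r hr0 y hy]
    simpa using heatFlow_nonneg h0 (r - ε) y

/-- Uniqueness of the bounded classical solution on a bounded open set. -/
theorem unique (hu : IsDirichletHeatSolution Ω u) (hv : IsDirichletHeatSolution Ω v)
    (hΩ : IsOpen Ω) (hb : Bornology.IsBounded Ω) {t : ℝ} (ht : 0 < t) {x : Plane} (hx : x ∈ Ω) :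
    u t x = v t x := by
  obtain ⟨M, hM⟩ := hu.bounded
  obtain ⟨N, hN⟩ := hv.bounded
  have hMN : 0 ≤ M + N :=
    add_nonneg ((abs_nonneg _).trans (hM t ht x hx)) ((abs_nonneg _).trans (hN t ht x hx))
  -- The datum of the barrier, extended by zero. The boundary condition makes it continuous on the
  -- plane, so its flow is continuous down to the starting time.
  let h : ℝ → Plane → ℝ := fun ε => Ω.indicator (fun y => |u ε y - v ε y|)
  have hcont : ∀ ε, 0 < ε → Continuous (h ε) := fun ε hε => by
    have h1 := continuousOn_indicator_of_frontier hΩ (w := fun ε y => |u ε y - v ε y|)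
      (hu.continuousOn.sub hv.continuousOn).abs
      (fun r hr y hy => by simp [hu.boundary r hr y hy, hv.boundary r hr y hy])
    have h2 : ContinuousOn (fun y : Plane => ((ε, y) : ℝ × Plane)) Set.univ := by fun_prop
    exact continuousOn_univ.1 (h1.comp h2 fun y _ => ⟨hε, trivial⟩)
  have hnn : ∀ ε y, 0 ≤ h ε y := fun ε y => Set.indicator_nonneg (fun _ _ => abs_nonneg _) y
  have hbd : ∀ ε, 0 < ε → ∀ y, |h ε y| ≤ M + N := fun ε hε y => by
    rw [abs_of_nonneg (hnn ε y)]
    by_cases hy : y ∈ Ω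
    · simp only [h, Set.indicator_of_mem hy]
      exact (abs_sub _ _).trans (add_le_add (hM ε hε y hy) (hN ε hε y hy))
    · simpa [h, hy] using hMN
  have hlecl : ∀ ε, 0 < ε → ∀ y ∈ closure Ω, |u ε y - v ε y| ≤ h ε y := fun ε hε y hy => by
    by_cases hyΩ : y ∈ Ω
    · simp [h, hyΩ]
    · have : y ∈ frontier Ω := by rw [hΩ.frontier_eq]; exact ⟨hy, hyΩ⟩
      simp [h, hyΩ, hu.boundary ε hε y this, hv.boundary ε hε y this]
  have hfin : volume Ω < ⊤ := hb.measure_lt_top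
  have hinteg : ∀ ε, 0 < ε → Integrable (h ε) := fun ε hε => by
    refine (integrable_indicator_iff hΩ.measurableSet).2 ?_
    have h1 : IntegrableOn (h ε) Ω :=
      Measure.integrableOn_of_bounded hfin.ne (hcont ε hε).aestronglyMeasurable (M := M + N)
        (ae_of_all _ fun y => hbd ε hε y)
    refine h1.congr_fun (fun y hy => ?_) hΩ.measurableSet
    simp [h, hy]
  -- Dominated convergence: both solutions tend to `1` pointwise in `Ω` and stay bounded, and `Ω`
  -- has finite measure. Nothing uniform near the frontier is needed.
  have hlim : Tendsto (fun ε => ∫ y, h ε y) (𝓝[>] 0) (𝓝 0) := by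
    have := tendsto_integral_filter_of_dominated_convergence (μ := volume) (l := 𝓝[>] (0 : ℝ))
      (F := h) (f := fun _ => 0) (Ω.indicator fun _ => M + N)
      (by filter_upwards [self_mem_nhdsWithin] with ε hε using (hcont ε hε).aestronglyMeasurable)
      (by
        filter_upwards [self_mem_nhdsWithin] with ε hε
        refine ae_of_all _ fun y => ?_
        by_cases hy : y ∈ Ω
        · simpa [hy] using hbd ε hε y
        · simp [h, hy])
      ((integrable_indicator_iff hΩ.measurableSet).2 (integrableOn_const hfin.ne))
      (ae_of_all _ fun y => by
        by_cases hy : y ∈ Ω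
        · have h1 := ((hu.initial y hy).sub (hv.initial y hy)).abs
          simpa [h, hy] using h1
        · simp [h, hy])
    simpa using this
  have hbound : ∀ᶠ ε in 𝓝[>] (0 : ℝ),
      |u t x - v t x| ≤ (4 * (t - ε))⁻¹ / Real.pi * ∫ y, h ε y := by
    filter_upwards [Ioo_mem_nhdsGT ht] with ε hε
    have h1 := hu.sub_le_heatFlow hv hΩ hb hε.1 hε.2.le (hcont ε hε.1) (hbd ε hε.1) (hnn ε)
      (fun y hy => (le_abs_self _).trans (hlecl ε hε.1 y hy)) hx
    have h2 := hv.sub_le_heatFlow hu hΩ hb hε.1 hε.2.le (hcont ε hε.1) (hbd ε hε.1) (hnn ε)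
      (fun y hy => (le_abs_self _).trans ((abs_sub_comm _ _).trans_le (hlecl ε hε.1 y hy))) hx
    have h3 := heatFlow_le_integral (hnn ε) (hinteg ε hε.1) (sub_pos.2 hε.2) x
    exact (abs_le.2 ⟨by linarith, h1⟩).trans h3
  have hlim2 : Tendsto (fun ε => (4 * (t - ε))⁻¹ / Real.pi * ∫ y, h ε y) (𝓝[>] 0)
      (𝓝 ((4 * (t - 0))⁻¹ / Real.pi * 0)) := by
    refine Tendsto.mul (Tendsto.div_const (Tendsto.inv₀ ?_ ?_) _) hlim
    · exact (Continuous.tendsto (by fun_prop : Continuous fun ε : ℝ => 4 * (t - ε)) 0).mono_left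
        nhdsWithin_le_nhds
    · simpa using ht.ne'
  rw [mul_zero] at hlim2
  have := ge_of_tendsto hlim2 hbound
  exact sub_eq_zero.1 (abs_eq_zero.1 (le_antisymm this (abs_nonneg _)))

end IsDirichletHeatSolution

/-! ### Disjoint unions. -/

/-- Solutions on two disjoint open sets, extended by zero, add up to a solution on the union. -/
lemma IsDirichletHeatSolution.union {r s : Set Plane} {u v : ℝ → Plane → ℝ}
    (hu : IsDirichletHeatSolution r u) (hv : IsDirichletHeatSolution s v)
    (hr : IsOpen r) (hs : IsOpen s) (hd : Disjoint r s) :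
    IsDirichletHeatSolution (r ∪ s) (fun t x => r.indicator (u t) x + s.indicator (v t) x) := by
  have er : ∀ x ∈ r, ∀ t, r.indicator (u t) x + s.indicator (v t) x = u t x := fun x hx t => by
    simp [hx, Set.disjoint_left.1 hd hx]
  have es : ∀ x ∈ s, ∀ t, r.indicator (u t) x + s.indicator (v t) x = v t x := fun x hx t => by
    simp [hx, Set.disjoint_right.1 hd hx]
  refine ⟨?_, ?_, ?_, ?_, ?_, ?_⟩
  · rintro ⟨t, x⟩ ⟨ht, hx | hx⟩
    · refine ContDiffAt.contDiffWithinAt (ContDiffAt.congr_of_eventuallyEq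
        (hu.contDiffOn.contDiffAt ((isOpen_Ioi.prod hr).mem_nhds ⟨ht, hx⟩)) ?_)
      filter_upwards [(isOpen_Ioi.prod hr).mem_nhds ⟨ht, hx⟩] with p hp using er p.2 hp.2 p.1
    · refine ContDiffAt.contDiffWithinAt (ContDiffAt.congr_of_eventuallyEq
        (hv.contDiffOn.contDiffAt ((isOpen_Ioi.prod hs).mem_nhds ⟨ht, hx⟩)) ?_)
      filter_upwards [(isOpen_Ioi.prod hs).mem_nhds ⟨ht, hx⟩] with p hp using es p.2 hp.2 p.1
  -- Each zero extension is continuous on the whole plane, so the two pieces may share boundary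
  -- points.
  · exact ((continuousOn_indicator_of_frontier hr hu.continuousOn hu.boundary).add
      (continuousOn_indicator_of_frontier hs hv.continuousOn hv.boundary)).mono
      (Set.prod_mono_right (Set.subset_univ _))
  · rintro t ht x (hx | hx)
    · have h1 : (fun x => r.indicator (u t) x + s.indicator (v t) x) =ᶠ[𝓝 x] u t := by
        filter_upwards [hr.mem_nhds hx] with y hy using er y hy t
      rw [(InnerProductSpace.laplacian_congr_nhds h1).eq_of_nhds]
      simp only [er x hx]
      exact hu.heat_eq t ht x hx
    · have h1 : (fun x => r.indicator (u t) x + s.indicator (v t) x) =ᶠ[𝓝 x] v t := by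
        filter_upwards [hs.mem_nhds hx] with y hy using es y hy t
      rw [(InnerProductSpace.laplacian_congr_nhds h1).eq_of_nhds]
      simp only [es x hx]
      exact hv.heat_eq t ht x hx
  · intro t ht x hx
    have hn : x ∉ r ∪ s := by
      rw [(hr.union hs).frontier_eq] at hx
      exact hx.2
    rw [Set.mem_union, not_or] at hn
    simp [hn.1, hn.2]
  · rintro x (hx | hx)
    · simp only [er x hx]
      exact hu.initial x hx
    · simp only [es x hx]
      exact hv.initial x hx
  · obtain ⟨M, hM⟩ := hu.bounded
    obtain ⟨N, hN⟩ := hv.bounded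
    refine ⟨max M N, fun t ht x hx => ?_⟩
    rcases hx with hx | hx
    · rw [er x hx]
      exact (hM t ht x hx).trans (le_max_left _ _)
    · rw [es x hx]
      exact (hN t ht x hx).trans (le_max_right _ _)

/-! ### Odd reflections of the initial datum. -/

lemma measurable_realSign : Measurable Real.sign := by
  unfold Real.sign
  exact Measurable.ite measurableSet_Iio measurable_const
    (Measurable.ite measurableSet_Ioi measurable_const measurable_const)

lemma abs_realSign_le (r : ℝ) : |Real.sign r| ≤ 1 := by
  rcases Real.sign_apply_eq r with h | h | h <;> rw [h] <;> norm_num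

/-- The flow commutes with the isometry `R`, so at a fixed point of `R` its value equals its own
negative. -/
lemma heatFlow_eq_zero_of_odd {f : Plane → ℝ} {R : Plane → Plane} (hR : Isometry R)
    (hinv : Function.Involutive R) (hf : ∀ y, f (R y) = -f y) (t : ℝ) {x : Plane} (hx : R x = x) :
    heatFlow f t x = 0 := by
  let e : Plane ≃ᵢ Plane := ⟨hinv.toPerm, hR⟩
  have h1 := heatFlow_comp_isometry f e.toRealAffineIsometryEquiv t x
  have h2 : ∀ y, e.toRealAffineIsometryEquiv y = R y := fun y => rfl
  simp only [h2, hf, hx] at h1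
  have h3 : heatFlow (fun y => -f y) t x = -heatFlow f t x := by
    simp [heatFlow, integral_neg]
  linarith

lemma isometry_of_coords {R : Plane → Plane}
    (h : ∀ x y : Plane, (R x 0 - R y 0) ^ 2 + (R x 1 - R y 1) ^ 2 =
      (x 0 - y 0) ^ 2 + (x 1 - y 1) ^ 2) : Isometry R := by
  refine Isometry.of_dist_eq fun x y => ?_
  rw [dist_eq_norm, dist_eq_norm, ← sq_eq_sq₀ (norm_nonneg _) (norm_nonneg _), Plane.norm_sq,
    Plane.norm_sq]
  exact h x y

lemma heatFlow_eq_zero_of_odd_fst {f : Plane → ℝ} {c : ℝ}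
    (hf : ∀ a b, f !₂[2 * c - a, b] = -f !₂[a, b]) (t : ℝ) {x : Plane} (hx : x 0 = c) :
    heatFlow f t x = 0 := by
  have he : ∀ y : Plane, y = !₂[y 0, y 1] := fun y => by ext i; fin_cases i <;> simp
  refine heatFlow_eq_zero_of_odd (R := fun y => !₂[2 * c - y 0, y 1]) ?_ ?_ ?_ t ?_
  · exact isometry_of_coords fun x y => by simp; ring
  · intro y; ext i; fin_cases i <;> simp
  · intro y
    rw [hf, ← he y]
  · ext i; fin_cases i <;> simp [hx]; ring

lemma heatFlow_eq_zero_of_odd_snd {f : Plane → ℝ} {c : ℝ}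
    (hf : ∀ a b, f !₂[a, 2 * c - b] = -f !₂[a, b]) (t : ℝ) {x : Plane} (hx : x 1 = c) :
    heatFlow f t x = 0 := by
  have he : ∀ y : Plane, y = !₂[y 0, y 1] := fun y => by ext i; fin_cases i <;> simp
  refine heatFlow_eq_zero_of_odd (R := fun y => !₂[y 0, 2 * c - y 1]) ?_ ?_ ?_ t ?_
  · exact isometry_of_coords fun x y => by simp; ring
  · intro y; ext i; fin_cases i <;> simp
  · intro y
    rw [hf, ← he y]
  · ext i; fin_cases i <;> simp [hx]; ring

lemma heatFlow_eq_zero_of_odd_antidiagonal {f : Plane → ℝ} {c : ℝ}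
    (hf : ∀ a b, f !₂[c - b, c - a] = -f !₂[a, b]) (t : ℝ) {x : Plane} (hx : x 0 + x 1 = c) :
    heatFlow f t x = 0 := by
  have he : ∀ y : Plane, y = !₂[y 0, y 1] := fun y => by ext i; fin_cases i <;> simp
  refine heatFlow_eq_zero_of_odd (R := fun y => !₂[c - y 1, c - y 0]) ?_ ?_ ?_ t ?_
  · exact isometry_of_coords fun x y => by simp; ring
  · intro y; ext i; fin_cases i <;> simp
  · intro y
    rw [hf, ← he y]
  · ext i; fin_cases i <;> simp <;> linarith

/-- The model open rectangle. -/
def modelRect (L H : ℝ) : Set Plane := {p : Plane | 0 < p 0 ∧ p 0 < L ∧ 0 < p 1 ∧ p 1 < H}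

/-- The model open right isosceles triangle. -/
def modelTri (L : ℝ) : Set Plane := {p : Plane | 0 < p 0 ∧ 0 < p 1 ∧ p 0 + p 1 < L}

/-- The extension of the constant `1` on an interval of length `L` to an odd periodic
function on the line. -/
def squareWave (L a : ℝ) : ℝ := Real.sign (Real.sin (Real.pi * a / L))

/-- The extension of the constant `1` on the rectangle by odd reflections. -/
def rectWave (L H : ℝ) (p : Plane) : ℝ := squareWave L (p 0) * squareWave H (p 1)

/-- The sign of `cos (π a / L) + cos (π b / L)`, which is `1` below and `-1` above the
antidiagonal of the square of side `L`. -/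
def diagonalWave (L a b : ℝ) : ℝ :=
  Real.sign (Real.cos (Real.pi * a / L) + Real.cos (Real.pi * b / L))

/-- The extension of the constant `1` on the triangle by odd reflections. -/
def triWave (L : ℝ) (p : Plane) : ℝ :=
  squareWave L (p 0) * squareWave L (p 1) * diagonalWave L (p 0) (p 1)

lemma isOpen_modelRect (L H : ℝ) : IsOpen (modelRect L H) := by
  simp only [modelRect, Set.ofPred_and]
  refine (isOpen_lt ?_ ?_).inter ((isOpen_lt ?_ ?_).inter ((isOpen_lt ?_ ?_).inter
    (isOpen_lt ?_ ?_))) <;> fun_prop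

lemma isOpen_modelTri (L : ℝ) : IsOpen (modelTri L) := by
  simp only [modelTri, Set.ofPred_and]
  refine (isOpen_lt ?_ ?_).inter ((isOpen_lt ?_ ?_).inter (isOpen_lt ?_ ?_)) <;> fun_prop

lemma isBounded_of_coords {S : Set Plane} {M : ℝ} (h : ∀ p ∈ S, |p 0| ≤ M ∧ |p 1| ≤ M) :
    Bornology.IsBounded S := by
  refine (Metric.isBounded_closedBall (x := (0 : Plane)) (r := √(M ^ 2 + M ^ 2))).subset
    fun p hp => ?_
  obtain ⟨h0, h1⟩ := h p hp
  rw [mem_closedBall_zero_iff]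
  refine Real.le_sqrt_of_sq_le ?_
  rw [Plane.norm_sq]
  exact add_le_add (sq_le_sq' (abs_le.1 h0).1 (abs_le.1 h0).2)
    (sq_le_sq' (abs_le.1 h1).1 (abs_le.1 h1).2)

lemma isBounded_modelRect (L H : ℝ) : Bornology.IsBounded (modelRect L H) := by
  refine isBounded_of_coords (M := max L H) fun p hp => ?_
  obtain ⟨h1, h2, h3, h4⟩ := hp
  exact ⟨abs_le.2 ⟨by linarith [le_max_left L H], h2.le.trans (le_max_left L H)⟩,
    abs_le.2 ⟨by linarith [le_max_right L H], h4.le.trans (le_max_right L H)⟩⟩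

lemma isBounded_modelTri (L : ℝ) : Bornology.IsBounded (modelTri L) := by
  refine isBounded_of_coords (M := L) fun p hp => ?_
  obtain ⟨h1, h2, h3⟩ := hp
  exact ⟨abs_le.2 ⟨by linarith, by linarith⟩, abs_le.2 ⟨by linarith, by linarith⟩⟩

lemma frontier_modelRect {L H : ℝ} {p : Plane} (hp : p ∈ frontier (modelRect L H)) :
    p 0 = 0 ∨ p 0 = L ∨ p 1 = 0 ∨ p 1 = H := by
  rw [(isOpen_modelRect L H).frontier_eq] at hp
  have hcl : closure (modelRect L H) ⊆ {p : Plane | 0 ≤ p 0 ∧ p 0 ≤ L ∧ 0 ≤ p 1 ∧ p 1 ≤ H} := by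
    refine closure_minimal (fun p hp => ⟨hp.1.le, hp.2.1.le, hp.2.2.1.le, hp.2.2.2.le⟩) ?_
    simp only [Set.ofPred_and]
    refine (isClosed_le ?_ ?_).inter ((isClosed_le ?_ ?_).inter ((isClosed_le ?_ ?_).inter
      (isClosed_le ?_ ?_))) <;> fun_prop
  obtain ⟨h1, h2, h3, h4⟩ := hcl hp.1
  by_contra! h
  exact hp.2 ⟨lt_of_le_of_ne h1 h.1.symm, lt_of_le_of_ne h2 h.2.1,
    lt_of_le_of_ne h3 h.2.2.1.symm, lt_of_le_of_ne h4 h.2.2.2⟩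

lemma frontier_modelTri {L : ℝ} {p : Plane} (hp : p ∈ frontier (modelTri L)) :
    p 0 = 0 ∨ p 1 = 0 ∨ p 0 + p 1 = L := by
  rw [(isOpen_modelTri L).frontier_eq] at hp
  have hcl : closure (modelTri L) ⊆ {p : Plane | 0 ≤ p 0 ∧ 0 ≤ p 1 ∧ p 0 + p 1 ≤ L} := by
    refine closure_minimal (fun p hp => ⟨hp.1.le, hp.2.1.le, hp.2.2.le⟩) ?_
    simp only [Set.ofPred_and]
    refine (isClosed_le ?_ ?_).inter ((isClosed_le ?_ ?_).inter (isClosed_le ?_ ?_)) <;> fun_prop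
  obtain ⟨h1, h2, h3⟩ := hcl hp.1
  by_contra! h
  exact hp.2 ⟨lt_of_le_of_ne h1 h.1.symm, lt_of_le_of_ne h2 h.2.1.symm, lt_of_le_of_ne h3 h.2.2⟩

lemma squareWave_neg (L a : ℝ) : squareWave L (-a) = -squareWave L a := by
  simp [squareWave, neg_div, Real.sign_neg]

lemma squareWave_add_period {L : ℝ} (hL : 0 < L) (a : ℝ) :
    squareWave L (a + 2 * L) = squareWave L a := by
  unfold squareWave
  rw [show Real.pi * (a + 2 * L) / L = Real.pi * a / L + 2 * Real.pi by field_simp,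
    Real.sin_add_two_pi]

lemma squareWave_sub {L : ℝ} (hL : 0 < L) (a : ℝ) : squareWave L (L - a) = squareWave L a := by
  unfold squareWave
  rw [show Real.pi * (L - a) / L = Real.pi - Real.pi * a / L by field_simp, Real.sin_pi_sub]

lemma squareWave_two_mul_sub {L : ℝ} (hL : 0 < L) (a : ℝ) :
    squareWave L (2 * L - a) = -squareWave L a := by
  rw [show 2 * L - a = -a + 2 * L by ring, squareWave_add_period hL, squareWave_neg]

lemma squareWave_eq_one {L a : ℝ} (h0 : 0 < a) (h1 : a < L) : squareWave L a = 1 := by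
  have hL : 0 < L := h0.trans h1
  refine Real.sign_of_pos (Real.sin_pos_of_pos_of_lt_pi (by positivity) ?_)
  rw [div_lt_iff₀ hL]
  exact mul_lt_mul_of_pos_left h1 Real.pi_pos

lemma diagonalWave_neg_left (L a b : ℝ) : diagonalWave L (-a) b = diagonalWave L a b := by
  simp [diagonalWave, neg_div]

lemma diagonalWave_neg_right (L a b : ℝ) : diagonalWave L a (-b) = diagonalWave L a b := by
  simp [diagonalWave, neg_div]

lemma diagonalWave_comm (L a b : ℝ) : diagonalWave L a b = diagonalWave L b a := by
  rw [diagonalWave, diagonalWave, add_comm]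

lemma diagonalWave_add_period {L : ℝ} (hL : 0 < L) (a b : ℝ) :
    diagonalWave L (a + 2 * L) b = diagonalWave L a b := by
  unfold diagonalWave
  rw [show Real.pi * (a + 2 * L) / L = Real.pi * a / L + 2 * Real.pi by field_simp,
    Real.cos_add_two_pi]

lemma diagonalWave_sub_sub {L : ℝ} (hL : 0 < L) (a b : ℝ) :
    diagonalWave L (L - a) (L - b) = -diagonalWave L a b := by
  unfold diagonalWave
  rw [show Real.pi * (L - a) / L = Real.pi - Real.pi * a / L by field_simp,
    show Real.pi * (L - b) / L = Real.pi - Real.pi * b / L by field_simp,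
    Real.cos_pi_sub, Real.cos_pi_sub, ← Real.sign_neg, neg_add]

/-- Since `a < L - b` and cosine is strictly decreasing on `[0, π]`, `cos (πa/L) > cos (π - πb/L) =
-cos (πb/L)`. -/
lemma diagonalWave_eq_one {L a b : ℝ} (hL : 0 < L) (h0 : 0 ≤ a) (h1 : 0 ≤ b) (h2 : a + b < L) :
    diagonalWave L a b = 1 := by
  refine Real.sign_of_pos ?_
  have h : Real.cos (Real.pi - Real.pi * b / L) < Real.cos (Real.pi * a / L) := by
    refine Real.cos_lt_cos_of_nonneg_of_le_pi (by positivity) ?_ ?_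
    · have : 0 ≤ Real.pi * b / L := by positivity
      linarith
    · rw [show Real.pi - Real.pi * b / L = Real.pi * (L - b) / L by field_simp]
      gcongr
      linarith
  rw [Real.cos_pi_sub] at h
  linarith

lemma measurable_squareWave (L : ℝ) : Measurable (squareWave L) :=
  measurable_realSign.comp (by fun_prop)

lemma measurable_diagonalWave (L : ℝ) : Measurable (fun p : ℝ × ℝ => diagonalWave L p.1 p.2) :=
  measurable_realSign.comp (by fun_prop)

lemma abs_squareWave_le (L a : ℝ) : |squareWave L a| ≤ 1 := abs_realSign_le _

lemma abs_rectWave_le (L H : ℝ) (p : Plane) : |rectWave L H p| ≤ 1 := by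
  rw [rectWave, abs_mul]
  exact mul_le_one₀ (abs_squareWave_le _ _) (abs_nonneg _) (abs_squareWave_le _ _)

lemma abs_triWave_le (L : ℝ) (p : Plane) : |triWave L p| ≤ 1 := by
  rw [triWave, abs_mul, abs_mul]
  exact mul_le_one₀ (mul_le_one₀ (abs_squareWave_le _ _) (abs_nonneg _) (abs_squareWave_le _ _))
    (abs_nonneg _) (abs_realSign_le _)

lemma measurable_squareWave_coord (L : ℝ) (k : Fin 2) :
    Measurable fun p : Plane => squareWave L (p k) :=
  (measurable_squareWave L).comp (by fun_prop : Measurable fun p : Plane => p k)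

lemma measurable_rectWave (L H : ℝ) : Measurable (rectWave L H) :=
  (measurable_squareWave_coord L 0).mul (measurable_squareWave_coord H 1)

lemma measurable_triWave (L : ℝ) : Measurable (triWave L) := by
  have h : Measurable fun p : Plane => diagonalWave L (p 0) (p 1) :=
    Measurable.comp (g := fun q : ℝ × ℝ => diagonalWave L q.1 q.2)
      (f := fun p : Plane => (p 0, p 1)) (measurable_diagonalWave L) (by fun_prop)
  exact ((measurable_squareWave_coord L 0).mul (measurable_squareWave_coord L 1)).mul h

lemma heatFlow_rectWave_frontier {L H : ℝ} (hL : 0 < L) (hH : 0 < H) (t : ℝ) {x : Plane}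
    (hx : x ∈ frontier (modelRect L H)) : heatFlow (rectWave L H) t x = 0 := by
  rcases frontier_modelRect hx with h | h | h | h
  · refine heatFlow_eq_zero_of_odd_fst (fun a b => ?_) t h
    simp [rectWave, squareWave_neg]
  · refine heatFlow_eq_zero_of_odd_fst (fun a b => ?_) t h
    simp [rectWave, squareWave_two_mul_sub hL]
  · refine heatFlow_eq_zero_of_odd_snd (fun a b => ?_) t h
    simp [rectWave, squareWave_neg]
  · refine heatFlow_eq_zero_of_odd_snd (fun a b => ?_) t h
    simp [rectWave, squareWave_two_mul_sub hH]

lemma heatFlow_triWave_frontier {L : ℝ} (hL : 0 < L) (t : ℝ) {x : Plane}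
    (hx : x ∈ frontier (modelTri L)) : heatFlow (triWave L) t x = 0 := by
  rcases frontier_modelTri hx with h | h | h
  · refine heatFlow_eq_zero_of_odd_fst (fun a b => ?_) t h
    simp [triWave, squareWave_neg, diagonalWave_neg_left]
  · refine heatFlow_eq_zero_of_odd_snd (fun a b => ?_) t h
    simp [triWave, squareWave_neg, diagonalWave_neg_right]
  · refine heatFlow_eq_zero_of_odd_antidiagonal (fun a b => ?_) t h
    -- Under `(a, b) ↦ (L - b, L - a)` the square waves are exchanged and only the diagonal factor
    -- changes sign.
    simp only [triWave, squareWave_sub hL, diagonalWave_sub_sub hL,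
      Matrix.cons_val_zero, Matrix.cons_val_one]
    rw [diagonalWave_comm L b a]
    ring

/-! ### Rigid motions and heat content. -/

lemma isDirichletHeatSolution_image {Ω : Set Plane} (hΩ : IsOpen Ω) {f : Plane → ℝ}
    (hf : Measurable f) {M : ℝ} (hM : ∀ y, |f y| ≤ M) (h1 : ∀ x ∈ Ω, f x = 1)
    (hb : ∀ t : ℝ, 0 < t → ∀ x ∈ frontier Ω, heatFlow f t x = 0) (φ : Plane ≃ᵃⁱ[ℝ] Plane) :
    IsDirichletHeatSolution (φ '' Ω) (heatFlow fun y => f (φ.symm y)) := by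
  have ho : IsOpen (φ '' Ω) := φ.toHomeomorph.isOpenMap Ω hΩ
  refine isDirichletHeatSolution_heatFlow ho (hf.comp φ.symm.continuous.measurable)
    (fun y => hM _) ?_ ?_
  · rintro _ ⟨x, hx, rfl⟩
    simpa using h1 x hx
  · intro t ht y hy
    rw [heatFlow_comp_isometry]
    refine hb t ht _ ?_
    have := φ.toHomeomorph.image_frontier Ω
    change φ '' frontier Ω = frontier (φ '' Ω) at this
    rw [← this] at hy
    obtain ⟨x, hx, rfl⟩ := hy
    simpa using hx

lemma measurePreserving_affineIsometryEquiv (φ : Plane ≃ᵃⁱ[ℝ] Plane) :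
    MeasurePreserving φ (volume : Measure Plane) volume := by
  have h : (φ : Plane → Plane) = (fun x => x + φ 0) ∘ φ.linearIsometryEquiv := by
    ext1 x
    have := φ.map_vadd 0 x
    simpa [vadd_eq_add] using this
  rw [h]
  exact (measurePreserving_add_right volume (φ 0)).comp φ.linearIsometryEquiv.measurePreserving

lemma setIntegral_heatFlow_image (f : Plane → ℝ) (Ω : Set Plane) (φ : Plane ≃ᵃⁱ[ℝ] Plane) (t : ℝ) :
    ∫ x in φ '' Ω, heatFlow (fun y => f (φ.symm y)) t x = ∫ x in Ω, heatFlow f t x := by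
  rw [(measurePreserving_affineIsometryEquiv φ).setIntegral_image_emb
    φ.toHomeomorph.measurableEmbedding]
  congr 1; ext x
  rw [heatFlow_comp_isometry f φ.symm t (φ x), AffineIsometryEquiv.symm_apply_apply]

/-- The heat content of the disjoint union of two rigidly moved model domains is the sum of the
integrals of the free flows of the reflected initial data. -/
theorem heatContent_union {Ω₁ Ω₂ : Set Plane} (hΩ₁ : IsOpen Ω₁) (hΩ₂ : IsOpen Ω₂)
    (hB₁ : Bornology.IsBounded Ω₁) (hB₂ : Bornology.IsBounded Ω₂) {f₁ f₂ : Plane → ℝ}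
    (hf₁ : Measurable f₁) (hf₂ : Measurable f₂) (hM₁ : ∀ y, |f₁ y| ≤ 1) (hM₂ : ∀ y, |f₂ y| ≤ 1)
    (h₁ : ∀ x ∈ Ω₁, f₁ x = 1) (h₂ : ∀ x ∈ Ω₂, f₂ x = 1)
    (hb₁ : ∀ t : ℝ, 0 < t → ∀ x ∈ frontier Ω₁, heatFlow f₁ t x = 0)
    (hb₂ : ∀ t : ℝ, 0 < t → ∀ x ∈ frontier Ω₂, heatFlow f₂ t x = 0)
    (φ ψ : Plane ≃ᵃⁱ[ℝ] Plane) (hd : Disjoint (φ '' Ω₁) (ψ '' Ω₂)) :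
    (∃ Q, IsHeatContent (φ '' Ω₁ ∪ ψ '' Ω₂) Q) ∧
      ∀ Q, IsHeatContent (φ '' Ω₁ ∪ ψ '' Ω₂) Q → ∀ t, 0 < t →
        Q t = (∫ x in Ω₁, heatFlow f₁ t x) + ∫ x in Ω₂, heatFlow f₂ t x := by
  have ho₁ : IsOpen (φ '' Ω₁) := φ.toHomeomorph.isOpenMap Ω₁ hΩ₁
  have ho₂ : IsOpen (ψ '' Ω₂) := ψ.toHomeomorph.isOpenMap Ω₂ hΩ₂
  have hbd₁ : Bornology.IsBounded (φ '' Ω₁) := φ.isometry.lipschitz.isBounded_image hB₁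
  have hbd₂ : Bornology.IsBounded (ψ '' Ω₂) := ψ.isometry.lipschitz.isBounded_image hB₂
  have hs₁ := isDirichletHeatSolution_image hΩ₁ hf₁ hM₁ h₁ hb₁ φ
  have hs₂ := isDirichletHeatSolution_image hΩ₂ hf₂ hM₂ h₂ hb₂ ψ
  have hs := hs₁.union hs₂ ho₁ ho₂ hd
  refine ⟨⟨_, _, hs, fun _ _ => rfl⟩, ?_⟩
  rintro Q ⟨u, hu, hQ⟩ t ht
  have hinteg : ∀ {S : Set Plane} {g : Plane → ℝ}, IsOpen S → Bornology.IsBounded S → Measurable g →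
      (∀ y, |g y| ≤ 1) → IntegrableOn (heatFlow g t) S := by
    intro S g hS hbS hg hg1
    exact Measure.integrableOn_of_bounded hbS.measure_lt_top.ne
      (continuous_heatFlow_space hg hg1 ht).aestronglyMeasurable (M := 1) (ae_of_all _ fun y => abs_heatFlow_le hg1 t y)
  have hi₁ := hinteg ho₁ hbd₁ (hf₁.comp φ.symm.continuous.measurable) fun y => hM₁ _
  have hi₂ := hinteg ho₂ hbd₂ (hf₂.comp ψ.symm.continuous.measurable) fun y => hM₂ _
  -- By uniqueness on the union, an arbitrary solution coincides with the reflected flow on each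
  -- piece.
  have e₁ : Set.EqOn (heatFlow (fun y => f₁ (φ.symm y)) t) (u t) (φ '' Ω₁) := fun x hx => by
    rw [hu.unique hs (ho₁.union ho₂) (hbd₁.union hbd₂) ht (Or.inl hx)]
    simp [Set.indicator_of_mem hx, Set.indicator_of_notMem (Set.disjoint_left.1 hd hx)]
  have e₂ : Set.EqOn (heatFlow (fun y => f₂ (ψ.symm y)) t) (u t) (ψ '' Ω₂) := fun x hx => by
    rw [hu.unique hs (ho₁.union ho₂) (hbd₁.union hbd₂) ht (Or.inr hx)]
    simp [Set.indicator_of_mem hx, Set.indicator_of_notMem (Set.disjoint_right.1 hd hx)]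
  rw [hQ t ht, setIntegral_union hd ho₂.measurableSet
    ((integrableOn_congr_fun e₁ ho₁.measurableSet).1 hi₁)
    ((integrableOn_congr_fun e₂ ho₂.measurableSet).1 hi₂),
    ← setIntegral_congr_fun ho₁.measurableSet e₁, ← setIntegral_congr_fun ho₂.measurableSet e₂,
    setIntegral_heatFlow_image, setIntegral_heatFlow_image]

/-! ### The heat flow of periodic functions on the line. -/

/-- The density of the one-dimensional heat kernel at time one. -/
def lineWeight (z : ℝ) : ℝ := (√(4 * Real.pi))⁻¹ * Real.exp (-(1 / 4) * z ^ 2)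

/-- The free heat flow on the line. -/
def lineFlow (f : ℝ → ℝ) (t x : ℝ) : ℝ := ∫ z, lineWeight z * f (x + √t * z)

lemma lineWeight_pos (z : ℝ) : 0 < lineWeight z := by
  unfold lineWeight; positivity

lemma continuous_lineWeight : Continuous lineWeight := by
  unfold lineWeight; fun_prop

lemma integrable_lineWeight : Integrable lineWeight :=
  (integrable_exp_neg_mul_sq (by norm_num)).const_mul _

lemma integral_lineWeight : ∫ z, lineWeight z = 1 := by
  unfold lineWeight
  rw [integral_const_mul, integral_gaussian, show Real.pi / (1 / 4) = 4 * Real.pi by ring,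
    inv_mul_cancel₀]
  positivity

lemma integrable_lineWeight_mul {f : ℝ → ℝ} (hf : Measurable f) {M : ℝ}
    (hM : ∀ y, |f y| ≤ M) (t x : ℝ) :
    Integrable (fun z => lineWeight z * f (x + √t * z)) := by
  refine (integrable_lineWeight.mul_const M).mono' ?_ (ae_of_all _ fun z => ?_)
  · exact (continuous_lineWeight.measurable.mul
      (hf.comp (by fun_prop))).aestronglyMeasurable
  · rw [Real.norm_eq_abs, abs_mul, abs_of_pos (lineWeight_pos z)]
    exact mul_le_mul_of_nonneg_left (hM _) (lineWeight_pos z).le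

lemma abs_lineFlow_le {f : ℝ → ℝ} {M : ℝ} (hM : ∀ y, |f y| ≤ M) (t x : ℝ) :
    |lineFlow f t x| ≤ M := by
  have := norm_integral_le_of_norm_le (f := fun z => lineWeight z * f (x + √t * z))
    (integrable_lineWeight.mul_const M) (ae_of_all _ fun z => by
      rw [Real.norm_eq_abs, abs_mul, abs_of_pos (lineWeight_pos z)]
      exact mul_le_mul_of_nonneg_left (hM _) (lineWeight_pos z).le)
  rwa [integral_mul_const, integral_lineWeight, one_mul] at this

lemma summable_pow_natAbs {r : ℝ} (h0 : 0 ≤ r) (h1 : r < 1) :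
    Summable (fun n : ℤ => r ^ n.natAbs) := by
  refine Summable.of_nat_of_neg ?_ ?_ <;> simpa using summable_geometric_of_lt_one h0 h1

lemma summable_pow_natAbs_sq {q : ℝ} (h0 : 0 ≤ q) (h1 : q < 1) :
    Summable (fun n : ℤ => q ^ (n.natAbs ^ 2)) :=
  (summable_pow_natAbs h0 h1).of_nonneg_of_le (fun n => by positivity) fun n =>
    pow_le_pow_of_le_one h0 h1.le (Nat.le_self_pow two_ne_zero _)

/-- Poisson summation for the periodized heat kernel. -/
lemma tsum_heatKernel_eq {t : ℝ} (ht : 0 < t) (x : ℝ) :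
    (√(4 * Real.pi * t))⁻¹ * ∑' n : ℤ, Real.exp (-(1 / (4 * t)) * (n - x) ^ 2) =
      ∑' n : ℤ, Real.exp (-4 * Real.pi ^ 2 * t) ^ (n.natAbs ^ 2) *
        Real.cos (2 * Real.pi * n * x) := by
  have hq0 := Real.exp_pos (-4 * Real.pi ^ 2 * t)
  have hq1 : Real.exp (-4 * Real.pi ^ 2 * t) < 1 := by
    rw [Real.exp_lt_one_iff]
    have : 0 < Real.pi ^ 2 * t := by positivity
    linarith
  have ha : 0 < (((4 * Real.pi * t : ℝ) : ℂ)).re := by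
    rw [Complex.ofReal_re]; positivity
  -- The theta functional equation with parameter `4πt` and imaginary shift `I * x`: the shift
  -- becomes a translation by `x` on the Gaussian side and a phase on the other, whose real part is
  -- the cosine.
  have h := Complex.tsum_exp_neg_quadratic ha (Complex.I * x)
  have hl : ∀ n : ℤ, Complex.exp (-Real.pi * ((4 * Real.pi * t : ℝ) : ℂ) * n ^ 2 +
      2 * Real.pi * (Complex.I * x) * n) =
      ((Real.exp (-4 * Real.pi ^ 2 * t) ^ (n.natAbs ^ 2) : ℝ) : ℂ) *
        Complex.exp ((2 * Real.pi * n * x : ℝ) * Complex.I) := by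
    intro n
    have hn : ((n.natAbs : ℝ)) ^ 2 = (n : ℝ) ^ 2 := by
      rw [Nat.cast_natAbs, Int.cast_abs, sq_abs]
    rw [← Real.exp_nat_mul, Complex.ofReal_exp, ← Complex.exp_add, Nat.cast_pow, hn]
    congr 1
    push_cast
    ring
  have hr : ∀ n : ℤ, Complex.exp (-Real.pi / ((4 * Real.pi * t : ℝ) : ℂ) *
      (n + Complex.I * (Complex.I * x)) ^ 2) =
      ((Real.exp (-(1 / (4 * t)) * (n - x) ^ 2) : ℝ) : ℂ) := by
    intro n
    rw [Complex.ofReal_exp]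
    congr 1
    have hI : (n : ℂ) + Complex.I * (Complex.I * x) = n - x := by
      rw [← mul_assoc, Complex.I_mul_I]; ring
    rw [hI]
    have htc : (t : ℂ) ≠ 0 := by exact_mod_cast ht.ne'
    have hpc : (Real.pi : ℂ) ≠ 0 := by exact_mod_cast Real.pi_ne_zero
    push_cast
    field_simp
  simp only [hl, hr] at h
  have hsum : Summable fun n : ℤ => ((Real.exp (-4 * Real.pi ^ 2 * t) ^ (n.natAbs ^ 2) : ℝ) : ℂ) *
        Complex.exp ((2 * Real.pi * n * x : ℝ) * Complex.I) := by
    refine Summable.of_norm ?_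
    refine (summable_pow_natAbs_sq hq0.le hq1).congr fun n => ?_
    rw [norm_mul, Complex.norm_exp_ofReal_mul_I, Complex.norm_real, mul_one, Real.norm_eq_abs,
      abs_of_pos (by positivity)]
  have hsq : ((4 * Real.pi * t : ℝ) : ℂ) ^ (1 / 2 : ℂ) = ((√(4 * Real.pi * t) : ℝ) : ℂ) := by
    rw [Real.sqrt_eq_rpow, Complex.ofReal_cpow (by positivity)]
    norm_num
  rw [hsq, ← Complex.ofReal_tsum] at h
  have h2 := congrArg Complex.re h
  rw [Complex.re_tsum hsum, one_div, ← Complex.ofReal_inv, ← Complex.ofReal_mul,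
    Complex.ofReal_re] at h2
  rw [← h2]
  refine tsum_congr fun n => ?_
  rw [Complex.re_ofReal_mul, Complex.exp_ofReal_mul_I_re]

/-- The explicit terms are those with `|n| ≤ 2`. The rest start at `q⁹` and are dominated by a
geometric series since `q ≤ 1/2`. -/
lemma abs_theta_sub_le {q : ℝ} (h0 : 0 ≤ q) (h1 : q ≤ 1 / 2) (x : ℝ) :
    |∑' n : ℤ, q ^ (n.natAbs ^ 2) * Real.cos (2 * Real.pi * n * x) -
      (1 + 2 * q * Real.cos (2 * Real.pi * x) + 2 * q ^ 4 * Real.cos (4 * Real.pi * x))| ≤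
    (8 * ∑' n : ℤ, (1 / 2 : ℝ) ^ n.natAbs) * q ^ 9 := by
  set F : ℤ → ℝ := fun n => q ^ (n.natAbs ^ 2) * Real.cos (2 * Real.pi * n * x)
  let S : Finset ℤ := {-2, -1, 0, 1, 2}
  have hF : Summable F := by
    refine Summable.of_norm_bounded (summable_pow_natAbs_sq h0 (by linarith)) fun n => ?_
    rw [norm_mul, Real.norm_eq_abs, Real.norm_eq_abs, abs_of_nonneg (by positivity)]
    exact mul_le_of_le_one_right (by positivity) (Real.abs_cos_le_one _)
  have hS : ∑ n ∈ S, F n =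
      1 + 2 * q * Real.cos (2 * Real.pi * x) + 2 * q ^ 4 * Real.cos (4 * Real.pi * x) := by
    have e1 : Real.cos (2 * Real.pi * 2 * x) = Real.cos (4 * Real.pi * x) := by ring_nf
    simp [S, F, e1]
    ring
  have hfin : HasSum (fun n => if n ∈ S then F n else 0) (∑ n ∈ S, F n) := by
    have := hasSum_sum_of_ne_finset_zero (L := SummationFilter.unconditional ℤ) (s := S)
      (f := fun n => if n ∈ S then F n else 0) (fun n hn => by simp [hn])
    rwa [Finset.sum_congr rfl fun n hn => by rw [if_pos hn]] at this
  have hG := hF.hasSum.sub hfin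
  rw [← hS, ← Real.norm_eq_abs]
  have hg := ((summable_pow_natAbs (r := 1 / 2) (by norm_num) (by norm_num)).hasSum.mul_left
    8).mul_right (q ^ 9)
  refine hG.norm_le_of_bounded hg fun n => ?_
  by_cases hn : n ∈ S
  · rw [if_pos hn, sub_self, norm_zero]
    positivity
  · rw [if_neg hn, sub_zero, Real.norm_eq_abs, abs_mul, abs_of_nonneg (by positivity)]
    have hk : 3 ≤ n.natAbs := by
      by_contra! hlt
      refine hn ?_
      simp only [S, Finset.mem_insert, Finset.mem_singleton]
      omega
    obtain ⟨k, hk⟩ := Nat.exists_eq_add_of_le hk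
    rw [hk]
    -- With `|n| = 3 + k`, the bound `(3 + k)² ≥ 9 + k` leaves a factor `q ^ k ≤ (1/2) ^ k`; the `8`
    -- converts `(1/2) ^ k` into `(1/2) ^ |n|`.
    calc q ^ (3 + k) ^ 2 * |Real.cos (2 * Real.pi * n * x)| ≤ q ^ (3 + k) ^ 2 * 1 := by
          gcongr; exact Real.abs_cos_le_one _
      _ ≤ q ^ (9 + k) := by
          rw [mul_one]
          exact pow_le_pow_of_le_one h0 (by linarith) (by nlinarith)
      _ = q ^ k * q ^ 9 := by rw [← pow_add]; ring_nf
      _ ≤ (1 / 2) ^ k * q ^ 9 := by gcongr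
      _ = 8 * (1 / 2) ^ (3 + k) * q ^ 9 := by rw [pow_add]; ring

lemma lineFlow_eq_kernel (f : ℝ → ℝ) {t : ℝ} (ht : 0 < t) (x : ℝ) :
    lineFlow f t x =
      ∫ y, (√(4 * Real.pi * t))⁻¹ * Real.exp (-(1 / (4 * t)) * (y - x) ^ 2) * f y := by
  have hs : 0 < √t := Real.sqrt_pos.2 ht
  have h := integral_add_right_eq_self (μ := volume)
    (fun y => (√(4 * Real.pi * t))⁻¹ * Real.exp (-(1 / (4 * t)) * (y - x) ^ 2) * f y) x
  rw [← h]
  have h2 := Measure.integral_comp_mul_left (fun y => (√(4 * Real.pi * t))⁻¹ *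
    Real.exp (-(1 / (4 * t)) * (y + x - x) ^ 2) * f (y + x)) (√t)
  rw [smul_eq_mul, abs_of_pos (inv_pos.2 hs), inv_mul_eq_div, eq_div_iff hs.ne'] at h2
  rw [← h2, ← integral_mul_const]
  unfold lineFlow
  congr 1; ext z
  rw [lineWeight, Real.sqrt_mul (by positivity) t, add_sub_cancel_right, mul_pow,
    Real.sq_sqrt ht.le, add_comm x]
  have : -(1 / (4 * t)) * (t * z ^ 2) = -(1 / 4) * z ^ 2 := by field_simp
  rw [this]
  field_simp

/-- Unfolding: the heat flow of a periodic function is an integral over one period against the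
periodized heat kernel. -/
lemma lineFlow_periodic {f : ℝ → ℝ} (hf : Measurable f) {M : ℝ} (hM : ∀ y, |f y| ≤ M)
    (hp : Function.Periodic f 1) {t : ℝ} (ht : 0 < t) (x : ℝ) :
    lineFlow f t x = ∫ y in (0 : ℝ)..1, (∑' n : ℤ, Real.exp (-4 * Real.pi ^ 2 * t) ^ (n.natAbs ^ 2) *
        Real.cos (2 * Real.pi * n * (x - y))) * f y := by
  let g : ℝ → ℝ := fun y =>
    (√(4 * Real.pi * t))⁻¹ * Real.exp (-(1 / (4 * t)) * (y - x) ^ 2) * f y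
  have hg : Integrable g := by
    have h1 : Integrable fun y : ℝ => Real.exp (-(1 / (4 * t)) * (y - x) ^ 2) :=
      (integrable_exp_neg_mul_sq (b := 1 / (4 * t)) (by positivity)).comp_sub_right x
    refine Integrable.mono' ((h1.const_mul (√(4 * Real.pi * t))⁻¹).mul_const M) ?_
      (ae_of_all _ fun y => ?_)
    · exact Measurable.aestronglyMeasurable (by fun_prop)
    · rw [Real.norm_eq_abs, abs_mul, abs_of_nonneg (by positivity)]
      gcongr
      exact hM y
  have hper : ∀ (y : ℝ) (n : ℤ), f (y + n) = f y := fun y n => by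
    simpa using hp.int_mul n y
  have h1 := hg.hasSum_intervalIntegral_comp_add_int
  have h2 := hg.norm.hasSum_intervalIntegral_comp_add_int
  simp only [intervalIntegral.integral_of_le zero_le_one] at h1 h2 ⊢
  have h3 := hasSum_integral_of_summable_integral_norm (μ := volume.restrict (Set.Ioc (0 : ℝ) 1))
    (F := fun (n : ℤ) y => g (y + n)) (fun n => (hg.comp_add_right (n : ℝ)).integrableOn)
    h2.summable
  rw [lineFlow_eq_kernel f ht x, h1.unique h3]
  congr 1; ext y
  simp only [g, hper]
  rw [tsum_mul_right, tsum_mul_left, ← tsum_heatKernel_eq ht (x - y)]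
  congr 5; ext n
  ring_nf

lemma continuous_theta_approx (q x : ℝ) : Continuous fun y : ℝ =>
    1 + 2 * q * Real.cos (2 * Real.pi * (x - y)) + 2 * q ^ 4 * Real.cos (4 * Real.pi * (x - y)) := by
  fun_prop

lemma intervalIntegrable_of_bounded {f : ℝ → ℝ} (hf : Measurable f) {M : ℝ}
    (hM : ∀ y, |f y| ≤ M) (a b : ℝ) : IntervalIntegrable f volume a b :=
  (intervalIntegrable_const (c := M)).mono_fun hf.aestronglyMeasurable
    (ae_of_all _ fun y => by
      simp only [Real.norm_eq_abs]
      exact (hM y).trans (le_abs_self M))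

/-- Over a period, an odd periodic function is orthogonal to even functions. -/
lemma integral_odd_periodic {g : ℝ → ℝ} (hp : Function.Periodic g 1) (ho : ∀ y, g (-y) = -g y) :
    ∫ y in (0 : ℝ)..1, g y = 0 := by
  have h1 : ∫ y in (0 : ℝ)..1, g y = ∫ y in (-1 : ℝ)..0, g y := by
    simpa using hp.intervalIntegral_add_eq 0 (-1)
  have h2 : ∫ y in (-1 : ℝ)..0, g y = -∫ y in (0 : ℝ)..1, g y := by
    have := intervalIntegral.integral_comp_neg (a := 0) (b := 1) g
    rw [neg_zero] at this
    rw [← this, ← intervalIntegral.integral_neg]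
    exact intervalIntegral.integral_congr fun y _ => ho y
  linarith

lemma integral_even_periodic {g : ℝ → ℝ} (hp : Function.Periodic g 1) (ho : ∀ y, g (-y) = g y)
    (hi : ∀ a b, IntervalIntegrable g volume a b) :
    ∫ y in (0 : ℝ)..1, g y = 2 * ∫ y in (0 : ℝ)..(1 / 2), g y := by
  have h1 : ∫ y in (0 : ℝ)..1, g y = ∫ y in (-(1 / 2) : ℝ)..(1 / 2), g y := by
    have := hp.intervalIntegral_add_eq 0 (-(1 / 2))
    norm_num at this ⊢
    exact this
  have h2 : ∫ y in (-(1 / 2) : ℝ)..0, g y = ∫ y in (0 : ℝ)..(1 / 2), g y := by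
    have := intervalIntegral.integral_comp_neg (a := 0) (b := 1 / 2) g
    rw [neg_zero] at this
    rw [← this]
    exact intervalIntegral.integral_congr fun y _ => ho y
  rw [h1, ← intervalIntegral.integral_add_adjacent_intervals (hi (-(1 / 2)) 0) (hi 0 (1 / 2)), h2]
  ring

/-- The constant in the two-mode approximation of the periodic heat flow. -/
def thetaConst : ℝ := 8 * ∑' n : ℤ, (1 / 2 : ℝ) ^ n.natAbs

lemma thetaConst_nonneg : 0 ≤ thetaConst :=
  mul_nonneg (by norm_num) (tsum_nonneg fun n => by positivity)

lemma exp_neg_four_pi_sq_le {t : ℝ} (ht : 1 ≤ t) : Real.exp (-4 * Real.pi ^ 2 * t) ≤ 1 / 2 := by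
  have h1 : (1 : ℝ) ≤ 4 * Real.pi ^ 2 * t := by nlinarith [Real.pi_gt_three]
  have h2 : Real.exp (-4 * Real.pi ^ 2 * t) ≤ Real.exp (-1) := Real.exp_le_exp.2 (by linarith)
  refine h2.trans ?_
  rw [Real.exp_neg, one_div]
  exact inv_anti₀ (by norm_num) (by linarith [Real.add_one_le_exp 1])

/-- Keep the modes `|n| ≤ 2` of the periodized kernel. Expanding `cos (2πn(x - y))`, oddness of `f`
kills the constant and cosine parts, and the sine parts reduce to integrals over half a period. -/
lemma lineFlow_approx_unit {f : ℝ → ℝ} (hf : Measurable f) {M : ℝ} (hM : ∀ y, |f y| ≤ M)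
    (hp : Function.Periodic f 1) (ho : ∀ y, f (-y) = -f y) {t : ℝ} (ht : 1 ≤ t) (x : ℝ) :
    |lineFlow f t x -
      (4 * Real.exp (-4 * Real.pi ^ 2 * t) * Real.sin (2 * Real.pi * x) *
          (∫ y in (0 : ℝ)..(1 / 2), Real.sin (2 * Real.pi * y) * f y) +
        4 * Real.exp (-4 * Real.pi ^ 2 * t) ^ 4 * Real.sin (4 * Real.pi * x) *
          (∫ y in (0 : ℝ)..(1 / 2), Real.sin (4 * Real.pi * y) * f y))| ≤
      thetaConst * M * Real.exp (-4 * Real.pi ^ 2 * t) ^ 9 := by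
  have ht0 : 0 < t := by linarith
  have hM0 : 0 ≤ M := (abs_nonneg _).trans (hM 0)
  have hq0 := (Real.exp_pos (-4 * Real.pi ^ 2 * t)).le
  have hq1 := exp_neg_four_pi_sq_le ht
  rw [lineFlow_periodic hf hM hp ht0 x]
  set q := Real.exp (-4 * Real.pi ^ 2 * t)
  have hi : ∀ g : ℝ → ℝ, Continuous g → ∀ a b : ℝ,
      IntervalIntegrable (fun y => g y * f y) volume a b := fun g hg a b =>
    (intervalIntegrable_of_bounded hf hM a b).continuousOn_mul hg.continuousOn
  have hperiod : ∀ n : ℕ, ∀ y : ℝ, 2 * Real.pi * n * (y + 1) = 2 * Real.pi * n * y + n * (2 * Real.pi) :=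
    fun n y => by ring
  have hcos : ∀ n : ℕ, ∫ y in (0 : ℝ)..1, Real.cos (2 * Real.pi * n * y) * f y = 0 := fun n => by
    refine integral_odd_periodic (fun y => ?_) fun y => ?_
    · simp only [hp y, hperiod, Real.cos_add_nat_mul_two_pi]
    · rw [ho, mul_neg (2 * Real.pi * n), Real.cos_neg, mul_neg]
  have hsin : ∀ n : ℕ, ∫ y in (0 : ℝ)..1, Real.sin (2 * Real.pi * n * y) * f y =
      2 * ∫ y in (0 : ℝ)..(1 / 2), Real.sin (2 * Real.pi * n * y) * f y := fun n => by
    refine integral_even_periodic (fun y => ?_) (fun y => ?_) (hi _ (by fun_prop))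
    · simp only [hp y, hperiod, Real.sin_add_nat_mul_two_pi]
    · rw [ho, mul_neg (2 * Real.pi * n), Real.sin_neg, neg_mul_neg]
  have hmode : ∀ n : ℕ, ∫ y in (0 : ℝ)..1, Real.cos (2 * Real.pi * n * (x - y)) * f y =
      2 * Real.sin (2 * Real.pi * n * x) *
        ∫ y in (0 : ℝ)..(1 / 2), Real.sin (2 * Real.pi * n * y) * f y := fun n => by
    have e : ∀ y, Real.cos (2 * Real.pi * n * (x - y)) * f y =
        Real.cos (2 * Real.pi * n * x) * (Real.cos (2 * Real.pi * n * y) * f y) +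
        Real.sin (2 * Real.pi * n * x) * (Real.sin (2 * Real.pi * n * y) * f y) := fun y => by
      rw [mul_sub, Real.cos_sub]; ring
    simp only [e]
    rw [intervalIntegral.integral_add ((hi _ (by fun_prop) _ _).const_mul _)
      ((hi _ (by fun_prop) _ _).const_mul _), intervalIntegral.integral_const_mul,
      intervalIntegral.integral_const_mul, hcos, hsin]
    ring
  have hmain : ∫ y in (0 : ℝ)..1, (1 + 2 * q * Real.cos (2 * Real.pi * (x - y)) +
        2 * q ^ 4 * Real.cos (4 * Real.pi * (x - y))) * f y =
      4 * q * Real.sin (2 * Real.pi * x) *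
          (∫ y in (0 : ℝ)..(1 / 2), Real.sin (2 * Real.pi * y) * f y) +
        4 * q ^ 4 * Real.sin (4 * Real.pi * x) *
          (∫ y in (0 : ℝ)..(1 / 2), Real.sin (4 * Real.pi * y) * f y) := by
    have e : ∀ y, (1 + 2 * q * Real.cos (2 * Real.pi * (x - y)) +
        2 * q ^ 4 * Real.cos (4 * Real.pi * (x - y))) * f y =
        1 * f y + 2 * q * (Real.cos (2 * Real.pi * (1 : ℕ) * (x - y)) * f y) +
        2 * q ^ 4 * (Real.cos (2 * Real.pi * (2 : ℕ) * (x - y)) * f y) := fun y => by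
      push_cast; ring_nf
    have i0 : IntervalIntegrable (fun y => 1 * f y) volume 0 1 := hi (fun _ => 1) (by fun_prop) 0 1
    have i1 (n : ℕ) (c : ℝ) : IntervalIntegrable
        (fun y => c * (Real.cos (2 * Real.pi * n * (x - y)) * f y)) volume 0 1 :=
      (hi _ (by fun_prop) 0 1).const_mul c
    simp only [e]
    rw [intervalIntegral.integral_add (i0.add (i1 1 _)) (i1 2 _),
      intervalIntegral.integral_add i0 (i1 1 _), intervalIntegral.integral_const_mul (2 * q),
      intervalIntegral.integral_const_mul (2 * q ^ 4), hmode, hmode]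
    -- The case `n = 0` says that `f` has mean zero over a period.
    have := hcos 0
    simp only [Nat.cast_zero, mul_zero, zero_mul, Real.cos_zero] at this
    rw [this]
    push_cast
    rw [show 2 * Real.pi * 2 = 4 * Real.pi by ring, mul_one]
    ring
  rw [← hmain]
  have hcont : Continuous fun y => ∑' n : ℤ, q ^ (n.natAbs ^ 2) *
      Real.cos (2 * Real.pi * n * (x - y)) := by
    refine continuous_tsum (u := fun n : ℤ => q ^ (n.natAbs ^ 2)) (fun n => by fun_prop)
      (summable_pow_natAbs_sq hq0 (by linarith)) fun n y => ?_
    rw [norm_mul, Real.norm_eq_abs, Real.norm_eq_abs, abs_of_nonneg (by positivity)]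
    exact mul_le_of_le_one_right (by positivity) (Real.abs_cos_le_one _)
  rw [← intervalIntegral.integral_sub (hi _ hcont 0 1) (hi _ (continuous_theta_approx q x) 0 1)]
  have := intervalIntegral.norm_integral_le_of_norm_le_const (a := 0) (b := 1)
    (C := thetaConst * M * q ^ 9) (f := fun y => (∑' n : ℤ, q ^ (n.natAbs ^ 2) *
      Real.cos (2 * Real.pi * n * (x - y))) * f y - (1 + 2 * q * Real.cos (2 * Real.pi * (x - y)) +
        2 * q ^ 4 * Real.cos (4 * Real.pi * (x - y))) * f y) (fun y _ => by
      rw [← sub_mul, norm_mul, Real.norm_eq_abs, Real.norm_eq_abs, mul_right_comm thetaConst]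
      refine mul_le_mul (abs_theta_sub_le hq0 hq1 (x - y)) (hM y) (abs_nonneg _) ?_
      exact mul_nonneg thetaConst_nonneg (by positivity))
  simpa using this

/-! ### Dirichlet modes of an interval. -/

/-- The `n`-th Dirichlet mode of the interval of length `L`. -/
def sineMode (L : ℝ) (n : ℕ) (x : ℝ) : ℝ := Real.sin (n * Real.pi * x / L)

/-- The decay factor of the first Dirichlet mode of the interval of length `L`. -/
def decay (L t : ℝ) : ℝ := Real.exp (-(Real.pi ^ 2 / L ^ 2) * t)

/-- Two-mode approximation of the heat flow of an odd `2 L`-periodic function. -/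
theorem lineFlow_approx {L : ℝ} (hL : 0 < L) {f : ℝ → ℝ} (hf : Measurable f) {M : ℝ}
    (hM : ∀ y, |f y| ≤ M) (hp : ∀ y, f (y + 2 * L) = f y) (ho : ∀ y, f (-y) = -f y) {t : ℝ}
    (ht : 4 * L ^ 2 ≤ t) (x : ℝ) :
    |lineFlow f t x -
      (2 / L * decay L t * sineMode L 1 x * (∫ y in (0 : ℝ)..L, sineMode L 1 y * f y) +
        2 / L * decay L t ^ 4 * sineMode L 2 x * (∫ y in (0 : ℝ)..L, sineMode L 2 y * f y))| ≤
      thetaConst * M * decay L t ^ 9 := by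
  -- Scaling space by `2 * L` to reach period `1` divides time by `4 * L ^ 2`, and the unit-period
  -- estimate needs rescaled time at least `1`.
  have ht' : 1 ≤ t / (4 * L ^ 2) := by rwa [le_div_iff₀ (by positivity), one_mul]
  have h := lineFlow_approx_unit (f := fun y => f (2 * L * y)) (hf.comp (by fun_prop))
    (fun y => hM _) (fun y => by simp only [mul_add, mul_one, hp])
    (fun y => by rw [mul_neg, ho]) ht' (x / (2 * L))
  have e1 : Real.exp (-4 * Real.pi ^ 2 * (t / (4 * L ^ 2))) = decay L t := by
    unfold decay; congr 1; field_simp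
  have e2 : lineFlow (fun y => f (2 * L * y)) (t / (4 * L ^ 2)) (x / (2 * L)) = lineFlow f t x := by
    unfold lineFlow
    congr 1; ext z
    congr 2
    rw [Real.sqrt_div' _ (by positivity), show 4 * L ^ 2 = (2 * L) ^ 2 by ring,
      Real.sqrt_sq (by positivity)]
    field_simp
  have e3 (n : ℕ) (c : ℝ) (hc : c = 2 * n * Real.pi) :
      ∫ y in (0 : ℝ)..(1 / 2), Real.sin (c * y) * f (2 * L * y) =
      (2 * L)⁻¹ * ∫ y in (0 : ℝ)..L, sineMode L n y * f y := by
    have := intervalIntegral.integral_comp_mul_left (a := 0) (b := 1 / 2)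
      (fun y => sineMode L n y * f y) (c := 2 * L) (by positivity)
    rw [mul_zero, show 2 * L * (1 / 2) = L by ring, smul_eq_mul] at this
    rw [← this]
    refine intervalIntegral.integral_congr fun y _ => ?_
    simp only [sineMode]
    congr 2
    rw [hc]; field_simp
  have e4 (n : ℕ) (c : ℝ) (hc : c = 2 * n * Real.pi) :
      Real.sin (c * (x / (2 * L))) = sineMode L n x := by
    unfold sineMode; congr 1; rw [hc]; field_simp
  rw [e1, e2, e3 1 (2 * Real.pi) (by simp), e3 2 (4 * Real.pi) (by push_cast; ring),
    e4 1 (2 * Real.pi) (by simp), e4 2 (4 * Real.pi) (by push_cast; ring)] at h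
  convert h using 3
  field_simp
  ring

/-! ### From the plane to the line. -/

lemma measurableEmbedding_planeMk : MeasurableEmbedding fun p : ℝ × ℝ => (!₂[p.1, p.2] : Plane) :=
  ((MeasurableEquiv.finTwoArrow (α := ℝ)).symm.trans
    (MeasurableEquiv.toLp 2 (Fin 2 → ℝ))).measurableEmbedding

lemma measurePreserving_planeMk :
    MeasurePreserving (fun p : ℝ × ℝ => (!₂[p.1, p.2] : Plane)) volume volume :=
  (PiLp.volume_preserving_toLp (Fin 2)).comp
    ((volume_preserving_finTwoArrow ℝ).symm (MeasurableEquiv.finTwoArrow (α := ℝ)))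

lemma heatWeight_mk (a b : ℝ) : heatWeight !₂[a, b] = lineWeight a * lineWeight b := by
  unfold heatWeight lineWeight
  rw [Plane.norm_sq]
  have h : (4 * Real.pi)⁻¹ = (√(4 * Real.pi))⁻¹ * (√(4 * Real.pi))⁻¹ := by
    rw [← mul_inv, Real.mul_self_sqrt (by positivity)]
  simp only [Matrix.cons_val_zero, Matrix.cons_val_one]
  rw [h, mul_add, Real.exp_add]
  ring

/-- The Gaussian weight factors over the coordinates, so Fubini gives the flow one variable at a
time, even for data that do not factor. -/
lemma heatFlow_eq_lineFlow {f : Plane → ℝ} (hf : Measurable f) {M : ℝ} (hM : ∀ y, |f y| ≤ M)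
    (t : ℝ) (x : Plane) :
    heatFlow f t x = lineFlow (fun b => lineFlow (fun a => f !₂[a, b]) t (x 0)) t (x 1) := by
  have hi : Integrable fun p : ℝ × ℝ => heatWeight !₂[p.1, p.2] *
      f (x + √t • (!₂[p.1, p.2] : Plane)) :=
    (measurePreserving_planeMk.integrable_comp_emb measurableEmbedding_planeMk).2
      (integrable_heatWeight_mul hf hM t x)
  unfold heatFlow
  rw [← measurePreserving_planeMk.integral_comp measurableEmbedding_planeMk,
    Measure.volume_eq_prod, integral_prod_symm _ hi]
  unfold lineFlow
  congr 1; ext b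
  rw [← integral_const_mul]
  congr 1; ext a
  have e : x + √t • (!₂[a, b] : Plane) = !₂[x 0 + √t * a, x 1 + √t * b] := by
    ext i; fin_cases i <;> simp
  rw [heatWeight_mk, e]
  ring

/-! ### Trigonometric integrals. -/

lemma intervalIntegral_congr_Ioo {a b : ℝ} (hab : a ≤ b) {f g : ℝ → ℝ}
    (h : ∀ x ∈ Set.Ioo a b, f x = g x) : ∫ x in a..b, f x = ∫ x in a..b, g x := by
  rw [intervalIntegral.integral_of_le hab, intervalIntegral.integral_of_le hab,
    integral_Ioc_eq_integral_Ioo, integral_Ioc_eq_integral_Ioo]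
  exact setIntegral_congr_fun measurableSet_Ioo h

lemma continuous_sineMode (L : ℝ) (n : ℕ) : Continuous (sineMode L n) := by
  unfold sineMode; fun_prop

lemma abs_sineMode_le (L : ℝ) (n : ℕ) (x : ℝ) : |sineMode L n x| ≤ 1 := Real.abs_sin_le_one _

lemma integral_sineMode {L : ℝ} (hL : 0 < L) {n : ℕ} (hn : n ≠ 0) (a c : ℝ) :
    ∫ x in a..c, sineMode L n x =
      L / (n * Real.pi) * (Real.cos (n * Real.pi * a / L) - Real.cos (n * Real.pi * c / L)) := by
  have hn' : (n : ℝ) ≠ 0 := Nat.cast_ne_zero.2 hn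
  have hd : ∀ x ∈ Set.uIcc a c, HasDerivAt
      (fun x => -(L / (n * Real.pi)) * Real.cos (n * Real.pi * x / L)) (sineMode L n x) x := by
    intro x _
    have h1 : HasDerivAt (fun x => n * Real.pi * x / L) (n * Real.pi / L) x := by
      simpa using ((hasDerivAt_id x).const_mul (n * Real.pi)).div_const L
    refine (h1.cos.const_mul _).congr_deriv ?_
    unfold sineMode
    field_simp
  rw [intervalIntegral.integral_eq_sub_of_hasDerivAt hd
    ((continuous_sineMode L n).intervalIntegrable _ _)]
  ring

lemma hasDerivAt_sin_div (L x : ℝ) : HasDerivAt (fun x => Real.sin (Real.pi * x / L))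
    (Real.cos (Real.pi * x / L) * (Real.pi / L)) x := by
  have h1 : HasDerivAt (fun x => Real.pi * x / L) (Real.pi / L) x := by
    simpa using ((hasDerivAt_id x).const_mul Real.pi).div_const L
  exact h1.sin

lemma hasDerivAt_cos_div (L x : ℝ) : HasDerivAt (fun x => Real.cos (Real.pi * x / L))
    (-Real.sin (Real.pi * x / L) * (Real.pi / L)) x := by
  have h1 : HasDerivAt (fun x => Real.pi * x / L) (Real.pi / L) x := by
    simpa using ((hasDerivAt_id x).const_mul Real.pi).div_const L
  exact h1.cos

lemma sineMode_one (L x : ℝ) : sineMode L 1 x = Real.sin (Real.pi * x / L) := by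
  simp [sineMode]

lemma sineMode_two (L x : ℝ) :
    sineMode L 2 x = 2 * Real.sin (Real.pi * x / L) * Real.cos (Real.pi * x / L) := by
  rw [← Real.sin_two_mul, sineMode]; congr 1; push_cast; ring

lemma integral_sineMode_one_mul_cos {L : ℝ} (hL : 0 < L) :
    ∫ x in (0 : ℝ)..L, sineMode L 1 x * Real.cos (Real.pi * x / L) = 0 := by
  have hd : ∀ x ∈ Set.uIcc 0 L, HasDerivAt
      (fun x => L / (2 * Real.pi) * Real.sin (Real.pi * x / L) ^ 2)
      (sineMode L 1 x * Real.cos (Real.pi * x / L)) x := fun x _ => by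
    refine (((hasDerivAt_sin_div L x).pow 2).const_mul _).congr_deriv ?_
    rw [sineMode_one]; field_simp; push_cast; ring
  rw [intervalIntegral.integral_eq_sub_of_hasDerivAt hd (Continuous.intervalIntegrable
    ((continuous_sineMode L 1).mul (by fun_prop)) _ _)]
  simp [hL.ne']

lemma integral_sineMode_two_mul_cos {L : ℝ} (hL : 0 < L) :
    ∫ x in (0 : ℝ)..L, sineMode L 2 x * Real.cos (Real.pi * x / L) = 4 * L / (3 * Real.pi) := by
  have hd : ∀ x ∈ Set.uIcc 0 L, HasDerivAt
      (fun x => -(2 * L / (3 * Real.pi)) * Real.cos (Real.pi * x / L) ^ 3)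
      (sineMode L 2 x * Real.cos (Real.pi * x / L)) x := fun x _ => by
    refine (((hasDerivAt_cos_div L x).pow 3).const_mul _).congr_deriv ?_
    rw [sineMode_two]; field_simp; push_cast; ring
  rw [intervalIntegral.integral_eq_sub_of_hasDerivAt hd (Continuous.intervalIntegrable
    ((continuous_sineMode L 2).mul (by fun_prop)) _ _)]
  simp [mul_div_assoc, hL.ne']
  ring

lemma integral_sineMode_one_mul_one_sub_cos {L : ℝ} (hL : 0 < L) :
    ∫ x in (0 : ℝ)..L, sineMode L 1 x * (1 - Real.cos (2 * Real.pi * x / L)) =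
      8 * L / (3 * Real.pi) := by
  have hd : ∀ x ∈ Set.uIcc 0 L, HasDerivAt
      (fun x => -(2 * L / Real.pi) *
        (Real.cos (Real.pi * x / L) - Real.cos (Real.pi * x / L) ^ 3 / 3))
      (sineMode L 1 x * (1 - Real.cos (2 * Real.pi * x / L))) x := fun x _ => by
    refine (((hasDerivAt_cos_div L x).sub
      (((hasDerivAt_cos_div L x).pow 3).div_const 3)).const_mul _).congr_deriv ?_
    rw [sineMode_one, show 2 * Real.pi * x / L = 2 * (Real.pi * x / L) by ring, Real.cos_two_mul]
    field_simp; push_cast; ring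
  rw [intervalIntegral.integral_eq_sub_of_hasDerivAt hd (Continuous.intervalIntegrable
    ((continuous_sineMode L 1).mul (by fun_prop)) _ _)]
  simp [mul_div_assoc, hL.ne']
  ring

lemma decay_pos (L t : ℝ) : 0 < decay L t := Real.exp_pos _

lemma decay_le_one (L : ℝ) {t : ℝ} (ht : 0 ≤ t) : decay L t ≤ 1 := by
  apply Real.exp_le_one_iff.2
  rw [neg_mul]
  exact neg_nonpos.2 (by positivity)

lemma tendsto_decay {L : ℝ} (hL : 0 < L) : Tendsto (decay L) atTop (𝓝 0) := by
  refine Real.tendsto_exp_atBot.comp ?_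
  exact tendsto_id.const_mul_atTop_of_neg (neg_neg_of_pos (by positivity))

/-! ### Heat content of intervals and rectangles. -/

/-- The heat content of an interval of length `L`. -/
def intervalContent (L t : ℝ) : ℝ := ∫ x in Set.Ioo 0 L, lineFlow (squareWave L) t x

/-- The second sine coefficient of the constant `1` is zero, so one mode already has an error of
order nine in the decay factor. -/
lemma lineFlow_squareWave_approx {L : ℝ} (hL : 0 < L) {t : ℝ} (ht : 4 * L ^ 2 ≤ t) (x : ℝ) :
    |lineFlow (squareWave L) t x - 4 / Real.pi * decay L t * sineMode L 1 x| ≤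
      thetaConst * decay L t ^ 9 := by
  have h := lineFlow_approx hL (measurable_squareWave L) (abs_squareWave_le L)
    (squareWave_add_period hL) (squareWave_neg L) ht x
  have e : ∀ n : ℕ, ∫ y in (0 : ℝ)..L, sineMode L n y * squareWave L y =
      ∫ y in (0 : ℝ)..L, sineMode L n y := fun n =>
    intervalIntegral_congr_Ioo hL.le fun y hy => by rw [squareWave_eq_one hy.1 hy.2, mul_one]
  rw [e, e, integral_sineMode hL one_ne_zero, integral_sineMode hL two_ne_zero, mul_one] at h
  convert h using 3
  have h1 : Real.cos (((1 : ℕ) : ℝ) * Real.pi * L / L) = -1 := by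
    rw [mul_div_cancel_right₀ _ hL.ne']; simp
  have h2 : Real.cos (((2 : ℕ) : ℝ) * Real.pi * L / L) = 1 := by
    rw [mul_div_cancel_right₀ _ hL.ne']; simp
  rw [h1, h2]
  simp
  field_simp
  ring

lemma measurable_lineFlow_mk {f : Plane → ℝ} (hf : Measurable f) (t : ℝ) (x : ℝ) :
    Measurable fun b => lineFlow (fun a => f !₂[a, b]) t x := by
  unfold lineFlow
  have h1 : Measurable fun p : ℝ × ℝ => (!₂[x + √t * p.2, p.1] : Plane) :=
    measurableEmbedding_planeMk.measurable.comp
      (by fun_prop : Measurable fun p : ℝ × ℝ => (x + √t * p.2, p.1))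
  have h : Measurable fun p : ℝ × ℝ => lineWeight p.2 * f !₂[x + √t * p.2, p.1] :=
    (continuous_lineWeight.measurable.comp measurable_snd).mul (hf.comp h1)
  exact h.stronglyMeasurable.integral_prod_right.measurable

lemma measurable_lineFlow {f : ℝ → ℝ} (hf : Measurable f) (t : ℝ) : Measurable (lineFlow f t) := by
  unfold lineFlow
  have h : Measurable fun p : ℝ × ℝ => lineWeight p.2 * f (p.1 + √t * p.2) :=
    (continuous_lineWeight.measurable.comp measurable_snd).mul (hf.comp (by fun_prop))
  exact h.stronglyMeasurable.integral_prod_right.measurable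

lemma abs_setIntegral_sub_le {α : Type*} [MeasurableSpace α] {μ : Measure α} {S : Set α}
    (hS : μ S ≠ ⊤) {u v : α → ℝ} (hu : IntegrableOn u S μ) (hv : IntegrableOn v S μ) {ε : ℝ}
    (h : ∀ x, |u x - v x| ≤ ε) :
    |(∫ x in S, u x ∂μ) - ∫ x in S, v x ∂μ| ≤ ε * μ.real S := by
  rw [← integral_sub hu hv]
  exact norm_setIntegral_le_of_norm_le_const (f := fun x => u x - v x) hS.lt_top fun x _ => h x

/-- An approximation up to a higher power of the decay factor determines a limit. -/
lemma tendsto_div_pow_decay {L : ℝ} (hL : 0 < L) {Q : ℝ → ℝ} {c C : ℝ} {m k : ℕ} (hk : 0 < k)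
    (h : ∀ᶠ t in atTop, |Q t - c * decay L t ^ m| ≤ C * decay L t ^ (m + k)) :
    Tendsto (fun t => Q t / decay L t ^ m) atTop (𝓝 c) := by
  rw [tendsto_iff_norm_sub_tendsto_zero]
  have h1 : Tendsto (fun t => C * decay L t ^ k) atTop (𝓝 0) := by
    simpa [hk.ne'] using ((tendsto_decay hL).pow k).const_mul C
  refine squeeze_zero' (Eventually.of_forall fun t => norm_nonneg _) ?_ h1
  filter_upwards [h] with t ht
  have hp : 0 < decay L t ^ m := pow_pos (decay_pos L t) m
  have e : Q t / decay L t ^ m - c = (Q t - c * decay L t ^ m) / decay L t ^ m := by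
    field_simp
  rw [e, norm_div, Real.norm_eq_abs, Real.norm_eq_abs, abs_of_pos hp, div_le_iff₀ hp]
  rw [pow_add] at ht
  linarith

lemma tendsto_intervalContent {L : ℝ} (hL : 0 < L) :
    Tendsto (fun t => intervalContent L t / decay L t) atTop (𝓝 (8 * L / Real.pi ^ 2)) := by
  have h : ∀ᶠ t in atTop, |intervalContent L t - 8 * L / Real.pi ^ 2 * decay L t ^ 1| ≤
      (thetaConst * L) * decay L t ^ (1 + 8) := by
    filter_upwards [eventually_ge_atTop (4 * L ^ 2)] with t ht
    have hfin : volume (Set.Ioo 0 L) ≠ ⊤ := by simp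
    have hb := abs_setIntegral_sub_le (S := Set.Ioo 0 L) hfin
      (Measure.integrableOn_of_bounded hfin
        (measurable_lineFlow (measurable_squareWave L) t).aestronglyMeasurable (M := 1)
        (ae_of_all _ fun x => abs_lineFlow_le (abs_squareWave_le L) t x))
      ((((continuous_sineMode L 1).const_mul (4 / Real.pi * decay L t)).integrableOn_Icc).mono_set
        Set.Ioo_subset_Icc_self)
      (lineFlow_squareWave_approx hL ht)
    have e : ∫ x in Set.Ioo 0 L, 4 / Real.pi * decay L t * sineMode L 1 x =
        8 * L / Real.pi ^ 2 * decay L t ^ 1 := by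
      rw [integral_const_mul, ← integral_Ioc_eq_integral_Ioo,
        ← intervalIntegral.integral_of_le hL.le, integral_sineMode hL one_ne_zero]
      have h1 : Real.cos (((1 : ℕ) : ℝ) * Real.pi * L / L) = -1 := by
        rw [mul_div_cancel_right₀ _ hL.ne']; simp
      rw [h1]
      simp
      field_simp
      ring
    rw [e] at hb
    refine hb.trans (le_of_eq ?_)
    rw [Real.volume_real_Ioo_of_le hL.le]
    ring
  simpa using tendsto_div_pow_decay hL (by norm_num) h

/-- Datum, Gaussian weight and domain are all products. -/
lemma setIntegral_modelRect (L H t : ℝ) :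
    ∫ x in modelRect L H, heatFlow (rectWave L H) t x =
      intervalContent L t * intervalContent H t := by
  rw [← measurePreserving_planeMk.setIntegral_preimage_emb measurableEmbedding_planeMk]
  have hpre : (fun p : ℝ × ℝ => (!₂[p.1, p.2] : Plane)) ⁻¹' modelRect L H =
      Set.Ioo 0 L ×ˢ Set.Ioo 0 H := by
    ext p; simp [modelRect, and_assoc]
  rw [hpre, Measure.volume_eq_prod, intervalContent, intervalContent, ← setIntegral_prod_mul]
  congr 1; ext p
  rw [heatFlow_eq_lineFlow (measurable_rectWave L H) (abs_rectWave_le L H)]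
  simp only [rectWave, lineFlow, Matrix.cons_val_zero, Matrix.cons_val_one, ← mul_assoc,
    integral_mul_const]
  rw [← integral_const_mul]
  congr 1; ext z
  ring

/-! ### Heat content of the right isosceles triangle. -/

/-- The `n`-th partial sine coefficient of the reflected triangle data, in the first variable. -/
def triCoeff (L : ℝ) (n : ℕ) (b : ℝ) : ℝ :=
  ∫ a in (0 : ℝ)..L, sineMode L n a * triWave L !₂[a, b]

lemma triWave_add_period_fst {L : ℝ} (hL : 0 < L) (a b : ℝ) :
    triWave L !₂[a + 2 * L, b] = triWave L !₂[a, b] := by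
  simp [triWave, squareWave_add_period hL, diagonalWave_add_period hL]

lemma triWave_neg_fst (L a b : ℝ) : triWave L !₂[-a, b] = -triWave L !₂[a, b] := by
  simp [triWave, squareWave_neg, diagonalWave_neg_left]

lemma triWave_comm (L a b : ℝ) : triWave L !₂[a, b] = triWave L !₂[b, a] := by
  simp only [triWave, Matrix.cons_val_zero, Matrix.cons_val_one]
  rw [diagonalWave_comm, mul_comm (squareWave L a)]

lemma triWave_eq_one {L a b : ℝ} (ha : 0 < a) (hb : 0 < b) (hab : a + b < L) :
    triWave L !₂[a, b] = 1 := by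
  simp [triWave, squareWave_eq_one ha (by linarith : a < L), squareWave_eq_one hb (by linarith : b < L),
    diagonalWave_eq_one (by linarith : 0 < L) ha.le hb.le hab]

/-- The point reflection `(a, b) ↦ (L - a, L - b)` carries the upper half of the square to the lower
one and reverses the diagonal sign. -/
lemma triWave_eq_neg_one {L a b : ℝ} (ha : a < L) (hb : b < L) (ha0 : 0 < a) (hb0 : 0 < b)
    (hab : L < a + b) : triWave L !₂[a, b] = -1 := by
  have hL : 0 < L := by linarith
  have h := diagonalWave_sub_sub hL a b
  rw [diagonalWave_eq_one hL (by linarith) (by linarith) (by linarith)] at h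
  simp only [triWave, Matrix.cons_val_zero, Matrix.cons_val_one, squareWave_eq_one ha0 ha,
    squareWave_eq_one hb0 hb]
  linarith

lemma measurable_triWave_mk (L b : ℝ) : Measurable fun a => triWave L !₂[a, b] :=
  (measurable_triWave L).comp
    (measurableEmbedding_planeMk.measurable.comp (by fun_prop : Measurable fun a : ℝ => (a, b)))

lemma measurable_triCoeff (L : ℝ) (n : ℕ) (hL : 0 ≤ L) : Measurable (triCoeff L n) := by
  unfold triCoeff
  simp only [intervalIntegral.integral_of_le hL]
  have h1 : Measurable fun p : ℝ × ℝ => (!₂[p.2, p.1] : Plane) :=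
    measurableEmbedding_planeMk.measurable.comp measurable_swap
  have h : Measurable fun p : ℝ × ℝ => sineMode L n p.2 * triWave L !₂[p.2, p.1] :=
    ((continuous_sineMode L n).measurable.comp measurable_snd).mul ((measurable_triWave L).comp h1)
  exact h.stronglyMeasurable.integral_prod_right.measurable

lemma abs_integral_sineMode_mul_le {L M : ℝ} (hL : 0 ≤ L) (n : ℕ) {g : ℝ → ℝ}
    (hg : ∀ a, |g a| ≤ M) : |∫ a in (0 : ℝ)..L, sineMode L n a * g a| ≤ M * L := by
  have := intervalIntegral.norm_integral_le_of_norm_le_const (a := 0) (b := L) (C := M)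
    (f := fun a => sineMode L n a * g a) fun a _ => by
      rw [norm_mul, Real.norm_eq_abs, Real.norm_eq_abs, ← one_mul M]
      exact mul_le_mul (abs_sineMode_le L n a) (hg a) (abs_nonneg _) zero_le_one
  rwa [sub_zero, abs_of_nonneg hL, Real.norm_eq_abs] at this

lemma abs_triCoeff_le {L : ℝ} (hL : 0 ≤ L) (n : ℕ) (b : ℝ) : |triCoeff L n b| ≤ L := by
  simpa [triCoeff] using abs_integral_sineMode_mul_le (M := 1) hL n fun a => abs_triWave_le L !₂[a, b]

lemma triCoeff_add_period {L : ℝ} (hL : 0 < L) (n : ℕ) (b : ℝ) :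
    triCoeff L n (b + 2 * L) = triCoeff L n b := by
  unfold triCoeff
  simp only [triWave_comm L _ (b + 2 * L), triWave_add_period_fst hL, triWave_comm L b]

lemma triCoeff_neg (L : ℝ) (n : ℕ) (b : ℝ) : triCoeff L n (-b) = -triCoeff L n b := by
  unfold triCoeff
  simp only [triWave_comm L _ (-b), triWave_neg_fst, triWave_comm L b, mul_neg,
    intervalIntegral.integral_neg]

/-- For fixed `b` the wave is `1` before `a = L - b` and `-1` after it, so the integral is split
there. -/
lemma triCoeff_eq {L : ℝ} {n : ℕ} (hn : n ≠ 0) {b : ℝ} (hb : b ∈ Set.Ioo 0 L) :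
    triCoeff L n b = L / (n * Real.pi) *
      (1 + Real.cos (n * Real.pi) - 2 * Real.cos (n * Real.pi * (L - b) / L)) := by
  have hL : 0 < L := hb.1.trans hb.2
  have hi : ∀ c d : ℝ, IntervalIntegrable (fun a => sineMode L n a * triWave L !₂[a, b])
      volume c d := fun c d =>
    (intervalIntegrable_of_bounded (measurable_triWave_mk L b)
      (fun a => abs_triWave_le L _) c d).continuousOn_mul (continuous_sineMode L n).continuousOn
  have h1 : ∫ a in (0 : ℝ)..(L - b), sineMode L n a * triWave L !₂[a, b] =
      ∫ a in (0 : ℝ)..(L - b), sineMode L n a :=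
    intervalIntegral_congr_Ioo (by linarith [hb.2]) fun a ha => by
      rw [triWave_eq_one ha.1 hb.1 (by linarith [ha.2]), mul_one]
  have h2 : ∫ a in (L - b)..L, sineMode L n a * triWave L !₂[a, b] =
      ∫ a in (L - b)..L, -sineMode L n a :=
    intervalIntegral_congr_Ioo (by linarith [hb.1]) fun a ha => by
      rw [triWave_eq_neg_one ha.2 hb.2 (by linarith [ha.1, hb.2]) hb.1 (by linarith [ha.1]),
        mul_neg_one]
  rw [triCoeff, ← intervalIntegral.integral_add_adjacent_intervals (hi 0 (L - b)) (hi (L - b) L),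
    h1, h2, intervalIntegral.integral_neg, integral_sineMode hL hn, integral_sineMode hL hn,
    mul_div_cancel_right₀ _ hL.ne']
  simp
  ring

lemma triCoeff_one {L b : ℝ} (hb : b ∈ Set.Ioo 0 L) :
    triCoeff L 1 b = 2 * L / Real.pi * Real.cos (Real.pi * b / L) := by
  have hL : 0 < L := hb.1.trans hb.2
  rw [triCoeff_eq one_ne_zero hb, Nat.cast_one, one_mul,
    show Real.pi * (L - b) / L = Real.pi - Real.pi * b / L by field_simp, Real.cos_pi_sub,
    Real.cos_pi]
  ring

lemma triCoeff_two {L b : ℝ} (hb : b ∈ Set.Ioo 0 L) :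
    triCoeff L 2 b = L / Real.pi * (1 - Real.cos (2 * Real.pi * b / L)) := by
  have hL : 0 < L := hb.1.trans hb.2
  rw [triCoeff_eq two_ne_zero hb, Nat.cast_two,
    show 2 * Real.pi * (L - b) / L = 2 * Real.pi - 2 * Real.pi * b / L by field_simp,
    Real.cos_two_pi_sub, Real.cos_two_pi]
  field_simp
  ring

/-- The `(1,1)` coefficient: the product of first modes is invariant under reflection in the
antidiagonal, where the wave is odd. Hence no term of order `decay L t ^ 2` occurs for the triangle.
-/
lemma integral_sineMode_one_triCoeff_one {L : ℝ} (hL : 0 < L) :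
    ∫ b in (0 : ℝ)..L, sineMode L 1 b * triCoeff L 1 b = 0 := by
  rw [intervalIntegral_congr_Ioo (g := fun b => 2 * L / Real.pi *
    (sineMode L 1 b * Real.cos (Real.pi * b / L))) hL.le fun b hb => by
      rw [triCoeff_one hb]; ring,
    intervalIntegral.integral_const_mul, integral_sineMode_one_mul_cos hL, mul_zero]

lemma integral_sineMode_two_triCoeff_one {L : ℝ} (hL : 0 < L) :
    ∫ b in (0 : ℝ)..L, sineMode L 2 b * triCoeff L 1 b = 8 * L ^ 2 / (3 * Real.pi ^ 2) := by
  rw [intervalIntegral_congr_Ioo (g := fun b => 2 * L / Real.pi *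
    (sineMode L 2 b * Real.cos (Real.pi * b / L))) hL.le fun b hb => by
      rw [triCoeff_one hb]; ring,
    intervalIntegral.integral_const_mul, integral_sineMode_two_mul_cos hL]
  field_simp
  ring

lemma integral_sineMode_one_triCoeff_two {L : ℝ} (hL : 0 < L) :
    ∫ b in (0 : ℝ)..L, sineMode L 1 b * triCoeff L 2 b = 8 * L ^ 2 / (3 * Real.pi ^ 2) := by
  rw [intervalIntegral_congr_Ioo (g := fun b => L / Real.pi *
    (sineMode L 1 b * (1 - Real.cos (2 * Real.pi * b / L)))) hL.le fun b hb => by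
      rw [triCoeff_two hb]; ring,
    intervalIntegral.integral_const_mul, integral_sineMode_one_mul_one_sub_cos hL]
  field_simp

lemma lineFlow_const_mul (f : ℝ → ℝ) (c t x : ℝ) :
    lineFlow (fun y => c * f y) t x = c * lineFlow f t x := by
  unfold lineFlow
  rw [← integral_const_mul]
  congr 1; ext z; ring

lemma lineFlow_sub {f g : ℝ → ℝ} (hf : Measurable f) (hg : Measurable g) {M N : ℝ}
    (hM : ∀ y, |f y| ≤ M) (hN : ∀ y, |g y| ≤ N) (t x : ℝ) :
    lineFlow (fun y => f y - g y) t x = lineFlow f t x - lineFlow g t x := by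
  unfold lineFlow
  rw [← integral_sub (integrable_lineWeight_mul hf hM t x) (integrable_lineWeight_mul hg hN t x)]
  congr 1; ext z; ring

/-- The lowest Dirichlet eigenfunction of the right isosceles triangle. -/
def triMode (L : ℝ) (x : Plane) : ℝ :=
  sineMode L 1 (x 0) * sineMode L 2 (x 1) + sineMode L 2 (x 0) * sineMode L 1 (x 1)

lemma continuous_triMode (L : ℝ) : Continuous (triMode L) := by
  unfold triMode sineMode
  fun_prop

/-- Apply the two-mode approximation in the first variable, then to each coefficient function in the
second. The modes `(1,2)` and `(2,1)` carry `q · q⁴` and the equal coefficient `(2/L)² · 8L²/(3π²) =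
32/(3π²)`. The error `5 * thetaConst + 4` is made of `thetaConst` from the first variable, `2 *
thetaConst` for each of the two coefficient functions, and `4` from the `(2,2)` mode. -/
theorem heatFlow_triWave_approx {L : ℝ} (hL : 0 < L) {t : ℝ} (ht : 4 * L ^ 2 ≤ t) (x : Plane) :
    |heatFlow (triWave L) t x - 32 / (3 * Real.pi ^ 2) * decay L t ^ 5 * triMode L x| ≤
      (5 * thetaConst + 4) * decay L t ^ 8 := by
  have ht0 : 0 ≤ t := le_trans (by positivity) ht
  have hq0 := (decay_pos L t).le
  have hq1 := decay_le_one L ht0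
  have hθ := thetaConst_nonneg
  rw [heatFlow_eq_lineFlow (measurable_triWave L) (abs_triWave_le L)]
  set q := decay L t with hq
  set s := x 0
  set r := x 1
  let c₁ : ℝ := 2 / L * q * sineMode L 1 s
  let c₂ : ℝ := 2 / L * q ^ 4 * sineMode L 2 s
  let V : ℝ → ℝ := fun b => lineFlow (fun a => triWave L !₂[a, b]) t s
  have hVm : Measurable V := measurable_lineFlow_mk (measurable_triWave L) t s
  have hVb : ∀ b, |V b| ≤ 1 := fun b => abs_lineFlow_le (fun a => abs_triWave_le L _) t s
  have hA := fun n => measurable_triCoeff L n hL.le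
  have hAb := fun n b => abs_triCoeff_le hL.le n b
  have h1 : ∀ b, |V b - c₁ * triCoeff L 1 b - c₂ * triCoeff L 2 b| ≤ thetaConst * q ^ 9 := by
    intro b
    have := lineFlow_approx hL (measurable_triWave_mk L b) (fun a => abs_triWave_le L !₂[a, b])
      (fun a => triWave_add_period_fst hL a b) (fun a => triWave_neg_fst L a b) ht s
    rw [mul_one] at this
    rwa [sub_sub]
  have hcb : ∀ (c : ℝ) (n : ℕ) (b : ℝ), |c * triCoeff L n b| ≤ |c| * L := fun c n b => by
    rw [abs_mul]; gcongr; exact hAb n b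
  -- The line flow is a contraction in the sup norm, so the error made in the first variable is not
  -- enlarged by the flow in the second.
  have h2 := abs_lineFlow_le h1 t r
  rw [lineFlow_sub (f := fun b => V b - c₁ * triCoeff L 1 b) (M := 1 + |c₁| * L) (hVm.sub ((hA 1).const_mul c₁)) ((hA 2).const_mul c₂)
      (fun b => (abs_sub _ _).trans (add_le_add (hVb b) (hcb c₁ 1 b))) (hcb c₂ 2),
    lineFlow_sub hVm ((hA 1).const_mul c₁) hVb (hcb c₁ 1), lineFlow_const_mul,
    lineFlow_const_mul] at h2
  have h3 := fun n => lineFlow_approx hL (hA n) (hAb n) (triCoeff_add_period hL n)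
    (triCoeff_neg L n) ht r
  have h31 := h3 1
  have h32 := h3 2
  rw [integral_sineMode_one_triCoeff_one hL, integral_sineMode_two_triCoeff_one hL] at h31
  rw [integral_sineMode_one_triCoeff_two hL] at h32
  have hB := abs_integral_sineMode_mul_le hL.le 2 (hAb 2)
  set B := ∫ b in (0 : ℝ)..L, sineMode L 2 b * triCoeff L 2 b
  set W := lineFlow V t r
  set W₁ := lineFlow (triCoeff L 1) t r
  set W₂ := lineFlow (triCoeff L 2) t r
  set K := 8 * L ^ 2 / (3 * Real.pi ^ 2) with hK
  rw [← hq] at h31 h32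
  set E₁ := W₁ - (2 / L * q * sineMode L 1 r * 0 + 2 / L * q ^ 4 * sineMode L 2 r * K) with hE₁
  set E₂ := W₂ - (2 / L * q * sineMode L 1 r * K + 2 / L * q ^ 4 * sineMode L 2 r * B) with hE₂
  have hc₁ : |c₁| ≤ 2 / L := by
    simp only [c₁]
    rw [abs_mul, abs_of_nonneg (by positivity : 0 ≤ 2 / L * q)]
    calc 2 / L * q * |sineMode L 1 s| ≤ 2 / L * 1 * 1 := by
          gcongr; exact abs_sineMode_le _ _ _
      _ = _ := by ring
  have hc₂ : |c₂| ≤ 2 / L := by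
    simp only [c₂]
    rw [abs_mul, abs_of_nonneg (by positivity : 0 ≤ 2 / L * q ^ 4)]
    calc 2 / L * q ^ 4 * |sineMode L 2 s| ≤ 2 / L * 1 * 1 := by
          gcongr
          · exact pow_le_one₀ hq0 hq1
          · exact abs_sineMode_le _ _ _
      _ = _ := by ring
  have hq98 : q ^ 9 ≤ q ^ 8 := pow_le_pow_of_le_one hq0 hq1 (by norm_num)
  have hT₁ : |c₁ * E₁| ≤ 2 * thetaConst * q ^ 8 := by
    rw [abs_mul]
    calc |c₁| * |E₁| ≤ 2 / L * (thetaConst * L * q ^ 8) := by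
          gcongr
          exact h31.trans (by gcongr)
      _ = _ := by field_simp
  have hT₂ : |c₂ * E₂| ≤ 2 * thetaConst * q ^ 8 := by
    rw [abs_mul]
    calc |c₂| * |E₂| ≤ 2 / L * (thetaConst * L * q ^ 8) := by
          gcongr
          exact h32.trans (by gcongr)
      _ = _ := by field_simp
  -- The `(2,2)` mode has order `q⁸`; the crude bound `|B| ≤ L * L` suffices, so its coefficient is
  -- not evaluated.
  have hT₃ : |c₂ * (2 / L * q ^ 4 * sineMode L 2 r * B)| ≤ 4 * q ^ 8 := by
    have e : c₂ * (2 / L * q ^ 4 * sineMode L 2 r * B) =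
        4 / L ^ 2 * q ^ 8 * (sineMode L 2 s * sineMode L 2 r * B) := by
      simp only [c₂]; field_simp; ring
    rw [e, abs_mul, abs_of_nonneg (by positivity : 0 ≤ 4 / L ^ 2 * q ^ 8), abs_mul, abs_mul]
    calc 4 / L ^ 2 * q ^ 8 * (|sineMode L 2 s| * |sineMode L 2 r| * |B|)
        ≤ 4 / L ^ 2 * q ^ 8 * (1 * 1 * (L * L)) := by
          gcongr
          · exact abs_sineMode_le _ _ _
          · exact abs_sineMode_le _ _ _
      _ = _ := by field_simp
  have hT₀ : |W - c₁ * W₁ - c₂ * W₂| ≤ thetaConst * q ^ 8 := h2.trans (by gcongr)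
  have key : W - 32 / (3 * Real.pi ^ 2) * q ^ 5 * triMode L x =
      (W - c₁ * W₁ - c₂ * W₂) + c₁ * E₁ + c₂ * E₂ +
        c₂ * (2 / L * q ^ 4 * sineMode L 2 r * B) := by
    simp only [hE₁, hE₂, c₁, c₂, triMode, hK]
    field_simp
    ring
  change |W - _| ≤ _
  rw [key]
  rw [abs_le] at *
  constructor <;> linarith [hT₀.1, hT₀.2, hT₁.1, hT₁.2, hT₂.1, hT₂.2, hT₃.1, hT₃.2]

lemma setIntegral_modelTri {L : ℝ} {g : Plane → ℝ} (hg : Continuous g) :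
    ∫ x in modelTri L, g x = ∫ b in Set.Ioo 0 L, ∫ a in Set.Ioo 0 (L - b), g !₂[a, b] := by
  have hm : MeasurableSet ((fun p : ℝ × ℝ => (!₂[p.1, p.2] : Plane)) ⁻¹' modelTri L) :=
    measurableEmbedding_planeMk.measurable (isOpen_modelTri L).measurableSet
  have hgi : IntegrableOn g (modelTri L) :=
    (hg.continuousOn.integrableOn_compact (isBounded_modelTri L).isCompact_closure).mono_set
      subset_closure
  have hi : Integrable (((fun p : ℝ × ℝ => (!₂[p.1, p.2] : Plane)) ⁻¹' modelTri L).indicator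
      fun p => g !₂[p.1, p.2]) := by
    refine (integrable_indicator_iff hm).2 ?_
    exact (measurePreserving_planeMk.integrableOn_comp_preimage measurableEmbedding_planeMk).2 hgi
  rw [← measurePreserving_planeMk.setIntegral_preimage_emb measurableEmbedding_planeMk,
    ← integral_indicator hm, Measure.volume_eq_prod, integral_prod_symm _ hi,
    ← integral_indicator measurableSet_Ioo]
  congr 1; ext b
  by_cases hb : b ∈ Set.Ioo 0 L
  · rw [Set.indicator_of_mem hb, ← integral_indicator measurableSet_Ioo]
    congr 1; ext a
    have : ((a, b) ∈ (fun p : ℝ × ℝ => (!₂[p.1, p.2] : Plane)) ⁻¹' modelTri L) ↔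
        a ∈ Set.Ioo 0 (L - b) := by
      simp [modelTri, hb.1, lt_sub_iff_add_lt]
    by_cases ha : a ∈ Set.Ioo 0 (L - b)
    · rw [Set.indicator_of_mem ha, Set.indicator_of_mem (this.2 ha)]
    · rw [Set.indicator_of_notMem ha, Set.indicator_of_notMem (mt this.1 ha)]
  · rw [Set.indicator_of_notMem hb]
    refine integral_eq_zero_of_ae (ae_of_all _ fun a => Set.indicator_of_notMem ?_ _)
    intro h
    simp only [modelTri, Set.mem_preimage, Set.mem_ofPred_eq, Matrix.cons_val_zero,
      Matrix.cons_val_one] at h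
    exact hb ⟨h.2.1, by linarith [h.1, h.2.2]⟩

lemma integral_triMode {L : ℝ} (hL : 0 < L) :
    ∫ x in modelTri L, triMode L x = 8 * L ^ 2 / (3 * Real.pi ^ 2) := by
  rw [setIntegral_modelTri (continuous_triMode L), ← integral_Ioc_eq_integral_Ioo,
    ← intervalIntegral.integral_of_le hL.le]
  have h : ∀ b ∈ Set.Ioo 0 L, ∫ a in Set.Ioo 0 (L - b), triMode L !₂[a, b] =
      L / Real.pi * (sineMode L 2 b + sineMode L 2 b * Real.cos (Real.pi * b / L)) +
      L / (2 * Real.pi) * (sineMode L 1 b * (1 - Real.cos (2 * Real.pi * b / L))) := by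
    intro b hb
    rw [← integral_Ioc_eq_integral_Ioo,
      ← intervalIntegral.integral_of_le (by linarith [hb.2] : (0 : ℝ) ≤ L - b)]
    simp only [triMode, Matrix.cons_val_zero, Matrix.cons_val_one]
    rw [intervalIntegral.integral_add
      (((continuous_sineMode L 1).mul_const _).intervalIntegrable _ _)
      (((continuous_sineMode L 2).mul_const _).intervalIntegrable _ _),
      intervalIntegral.integral_mul_const, intervalIntegral.integral_mul_const,
      integral_sineMode hL one_ne_zero, integral_sineMode hL two_ne_zero,
      Nat.cast_one, Nat.cast_two, one_mul,
      show Real.pi * (L - b) / L = Real.pi - Real.pi * b / L by field_simp, Real.cos_pi_sub,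
      show 2 * Real.pi * (L - b) / L = 2 * Real.pi - 2 * Real.pi * b / L by field_simp,
      Real.cos_two_pi_sub]
    simp
    ring
  have hs := continuous_sineMode L
  have i₁ : IntervalIntegrable (fun b => sineMode L 2 b * Real.cos (Real.pi * b / L)) volume 0 L :=
    Continuous.intervalIntegrable ((hs 2).mul (by fun_prop)) _ _
  have i₂ : IntervalIntegrable (fun b => L / Real.pi *
      (sineMode L 2 b + sineMode L 2 b * Real.cos (Real.pi * b / L))) volume 0 L :=
    (((hs 2).intervalIntegrable _ _).add i₁).const_mul _
  have i₃ : IntervalIntegrable (fun b => L / (2 * Real.pi) *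
      (sineMode L 1 b * (1 - Real.cos (2 * Real.pi * b / L)))) volume 0 L :=
    Continuous.intervalIntegrable (continuous_const.mul ((hs 1).mul (by fun_prop))) _ _
  rw [intervalIntegral_congr_Ioo hL.le h, intervalIntegral.integral_add i₂ i₃,
    intervalIntegral.integral_const_mul, intervalIntegral.integral_const_mul,
    intervalIntegral.integral_add ((hs 2).intervalIntegrable _ _) i₁,
    integral_sineMode_two_mul_cos hL, integral_sineMode_one_mul_one_sub_cos hL,
    integral_sineMode hL two_ne_zero, mul_div_cancel_right₀ _ hL.ne']
  simp
  field_simp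
  ring

lemma tendsto_triContent {L : ℝ} (hL : 0 < L) :
    Tendsto (fun t => (∫ x in modelTri L, heatFlow (triWave L) t x) / decay L t ^ 5) atTop
      (𝓝 (256 * L ^ 2 / (9 * Real.pi ^ 4))) := by
  -- The leading order is `5` and the error order `8`, whence `k = 3`; the limit is `32/(3π²)` times
  -- the integral `8L²/(3π²)` of the mode.
  refine tendsto_div_pow_decay hL (k := 3)
    (C := (5 * thetaConst + 4) * volume.real (modelTri L)) (by norm_num) ?_
  filter_upwards [eventually_ge_atTop (4 * L ^ 2)] with t ht
  have ht0 : 0 < t := lt_of_lt_of_le (by positivity) ht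
  have hfin : volume (modelTri L) ≠ ⊤ := (isBounded_modelTri L).measure_lt_top.ne
  have hc := continuous_heatFlow_space (measurable_triWave L) (abs_triWave_le L) ht0
  have hinteg : ∀ g : Plane → ℝ, Continuous g → IntegrableOn g (modelTri L) := fun g hg =>
    (hg.continuousOn.integrableOn_compact (isBounded_modelTri L).isCompact_closure).mono_set
      subset_closure
  have h := abs_setIntegral_sub_le hfin (hinteg _ hc)
    (hinteg _ ((continuous_triMode L).const_mul (32 / (3 * Real.pi ^ 2) * decay L t ^ 5)))
    (heatFlow_triWave_approx hL ht)
  rw [integral_const_mul, integral_triMode hL] at h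
  convert h using 1
  · congr 2
    field_simp
    ring
  · ring

/-! ### Comparison of the two Chapman domains. -/

/-- Existence of the heat content of the disjoint union of a rectangle and a right isosceles
triangle, and its value. -/
lemma heatContent_rectangle_union_triangle {L H K : ℝ} (hL : 0 < L) (hH : 0 < H) (hK : 0 < K)
    {r s : Set Plane} (hr : IsOpenRectangle L H r) (hs : IsOpenRightIsoscelesTriangle K s)
    (hd : Disjoint r s) :
    (∃ Q, IsHeatContent (r ∪ s) Q) ∧ ∀ Q, IsHeatContent (r ∪ s) Q → ∀ t, 0 < t →
      Q t = intervalContent L t * intervalContent H t +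
        ∫ x in modelTri K, heatFlow (triWave K) t x := by
  obtain ⟨φ, rfl⟩ := hr
  obtain ⟨ψ, rfl⟩ := hs
  have h := heatContent_union (isOpen_modelRect L H) (isOpen_modelTri K)
    (isBounded_modelRect L H) (isBounded_modelTri K) (measurable_rectWave L H)
    (measurable_triWave K) (abs_rectWave_le L H) (abs_triWave_le K)
    (fun x hx => by
      rw [rectWave, squareWave_eq_one hx.1 hx.2.1, squareWave_eq_one hx.2.2.1 hx.2.2.2, one_mul])
    (fun x hx => by
      rw [triWave, squareWave_eq_one hx.1 (by linarith [hx.2.1, hx.2.2]),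
        squareWave_eq_one hx.2.1 (by linarith [hx.1, hx.2.2]),
        diagonalWave_eq_one hK hx.1.le hx.2.1.le hx.2.2, one_mul, one_mul])
    (fun t _ x hx => heatFlow_rectWave_frontier hL hH t hx)
    (fun t _ x hx => heatFlow_triWave_frontier hK t hx) φ ψ hd
  simp only [setIntegral_modelRect] at h
  exact h

lemma tendsto_rectContent_mul {L H : ℝ} (hL : 0 < L) (hH : 0 < H) :
    Tendsto (fun t => intervalContent L t * intervalContent H t / (decay L t * decay H t)) atTop
      (𝓝 (64 * L * H / Real.pi ^ 4)) := by
  have h := (tendsto_intervalContent hL).mul (tendsto_intervalContent hH)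
  convert h using 2
  · rw [div_mul_div_comm]
  · field_simp
    ring

lemma tendsto_exp_mul_of_decay {Q : ℝ → ℝ} {c l μ : ℝ} (hμ : μ < l)
    (h : Tendsto (fun t => Q t / Real.exp (-l * t)) atTop (𝓝 c)) :
    Tendsto (fun t => Real.exp (μ * t) * Q t) atTop (𝓝 0) := by
  have h1 : Tendsto (fun t : ℝ => Real.exp (-(l - μ) * t)) atTop (𝓝 0) :=
    Real.tendsto_exp_atBot.comp
      (tendsto_id.const_mul_atTop_of_neg (neg_neg_of_pos (sub_pos.2 hμ)))
  have h2 := h1.mul h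
  rw [zero_mul] at h2
  refine h2.congr fun t => ?_
  rw [show -(l - μ) * t = μ * t + -l * t by ring, Real.exp_add]
  field_simp

lemma decay_pow (L t : ℝ) (n : ℕ) : decay L t ^ n = Real.exp (-(n * (Real.pi ^ 2 / L ^ 2)) * t) := by
  rw [decay, ← Real.exp_nat_mul]; ring_nf

/-- The leading large-time behaviour of the heat content of the first Chapman domain. -/
lemma tendsto_content_chapman₁ :
    Tendsto (fun t => Real.exp (5 * Real.pi ^ 2 / 4 * t) *
      (intervalContent 1 t * intervalContent 1 t + ∫ x in modelTri 2, heatFlow (triWave 2) t x))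
      atTop (𝓝 (1024 / (9 * Real.pi ^ 4))) := by
  have hπ : 0 < Real.pi ^ 2 := by positivity
  -- The unit square decays at the rate `2π²`, faster than `5π²/4`.
  have h1 : Tendsto (fun t => Real.exp (5 * Real.pi ^ 2 / 4 * t) *
      (intervalContent 1 t * intervalContent 1 t)) atTop (𝓝 0) := by
    refine tendsto_exp_mul_of_decay (l := 2 * Real.pi ^ 2) (by linarith)
      ((tendsto_rectContent_mul one_pos one_pos).congr fun t => ?_)
    congr 1
    rw [decay, ← Real.exp_add]
    ring_nf
  have h2 := (tendsto_triContent (L := 2) two_pos).congr (f₂ := fun t =>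
      Real.exp (5 * Real.pi ^ 2 / 4 * t) * ∫ x in modelTri 2, heatFlow (triWave 2) t x) fun t => by
    rw [decay_pow, div_eq_mul_inv, ← Real.exp_neg, mul_comm]
    congr 2
    push_cast
    ring
  have h3 := h1.add h2
  rw [zero_add] at h3
  convert h3 using 2
  · ring
  · ring

/-- The leading large-time behaviour of the heat content of the second Chapman domain. -/
lemma tendsto_content_chapman₂ :
    Tendsto (fun t => Real.exp (5 * Real.pi ^ 2 / 4 * t) *
      (intervalContent 2 t * intervalContent 1 t +
        ∫ x in modelTri (√2), heatFlow (triWave (√2)) t x))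
      atTop (𝓝 (128 / Real.pi ^ 4)) := by
  have hπ : 0 < Real.pi ^ 2 := by positivity
  have h1 := (tendsto_rectContent_mul two_pos one_pos).congr (f₂ := fun t =>
      Real.exp (5 * Real.pi ^ 2 / 4 * t) * (intervalContent 2 t * intervalContent 1 t)) fun t => by
    rw [decay, decay, ← Real.exp_add, div_eq_mul_inv, ← Real.exp_neg, mul_comm]
    congr 2
    ring
  -- With legs `√2` the triangle decays at the rate `5π²/2`, twice that of the rectangle.
  have h2 : Tendsto (fun t => Real.exp (5 * Real.pi ^ 2 / 4 * t) *
      ∫ x in modelTri (√2), heatFlow (triWave (√2)) t x) atTop (𝓝 0) := by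
    refine tendsto_exp_mul_of_decay (l := 5 * (Real.pi ^ 2 / 2)) (by linarith)
      ((tendsto_triContent (Real.sqrt_pos.2 two_pos)).congr fun t => ?_)
    rw [decay_pow, Real.sq_sqrt two_pos.le]
    norm_num
  have h3 := h1.add h2
  rw [add_zero] at h3
  convert h3 using 2
  · ring
  · ring

end

theorem mainTheorem4 (C₁ C₂ : Set Plane) (h₁ : IsChapmanDomain₁ C₁) (h₂ : IsChapmanDomain₂ C₂) :
    (∃ Q₁ : ℝ → ℝ, IsHeatContent C₁ Q₁) ∧ (∃ Q₂ : ℝ → ℝ, IsHeatContent C₂ Q₂) ∧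
      ∀ Q₁ Q₂ : ℝ → ℝ, IsHeatContent C₁ Q₁ → IsHeatContent C₂ Q₂ →
        ∃ t : ℝ, 0 < t ∧ Q₁ t ≠ Q₂ t := by
  obtain ⟨r₁, s₁, hr₁, hs₁, hd₁, rfl⟩ := h₁
  obtain ⟨r₂, s₂, hr₂, hs₂, hd₂, rfl⟩ := h₂
  obtain ⟨ex₁, val₁⟩ :=
    heatContent_rectangle_union_triangle one_pos one_pos two_pos hr₁ hs₁ hd₁
  obtain ⟨ex₂, val₂⟩ :=
    heatContent_rectangle_union_triangle two_pos one_pos (Real.sqrt_pos.2 two_pos) hr₂ hs₂ hd₂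
  refine ⟨ex₁, ex₂, fun Q₁ Q₂ hQ₁ hQ₂ => ?_⟩
  by_contra! hEq
  -- Equal contents would give equal rescaled limits, that is `1024/9 = 128`.
  have hlim := tendsto_nhds_unique (tendsto_content_chapman₁.congr' (by
    filter_upwards [Filter.eventually_gt_atTop 0] with t ht
    rw [← val₁ Q₁ hQ₁ t ht, hEq t ht, val₂ Q₂ hQ₂ t ht])) tendsto_content_chapman₂
  have hπ : 0 < Real.pi ^ 4 := by positivity
  field_simp at hlim
  norm_num at hlim
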